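/- Let $d\ge 1$, let $I\subseteq\mathbb{R}$ be an open interval and let $\gamma:I\to\mathbb{R}^d$ be $d$ times continuously differentiable. Put $$L_\gamma(t)=\det(\gamma'(t),\dots,\gamma^{(d)}(t)),\qquad \lambda_\gamma(t)=|L_\gamma(t)|^{\frac{2}{d(d+1)}},$$ let $J_\gamma$ be the Jacobian determinant of the map $(t_1,\dots,t_d)\mapsto\sum_{j=1}^d(-1)^j\gamma(t_j)$, and for nonnegative Borel functions $g$ on $\mathbb{R}^d$ let $$T_\gamma g(x)=\int_I g(x-\gamma(t))\,\lambda_\gamma(t)\,dt\in[0,\infty],\qquad x\in\mathbb{R}^d.$$ Assume that there is a constant $C_\gamma>0$ such that $$|J_\gamma(t_1,\dots,t_d)|\ \ge\ C_\gamma\prod_{j=1}^d|L_\gamma(t_j)|^{\frac1d}\prod_{1\le i<j\le d}|t_j-t_i|\qquad\text{for all }(t_1,\dots,t_d)\in I^d,$$ and that there are constants $c_1,c_2>0$ and a log-concave function $f:I\to[0,\infty)$, i.e. $f(\theta t_1+(1-\theta)t_2)\ge f(t_1)^{\theta}f(t_2)^{1-\theta}$ for all $t_1,t_2\in I$ and $0\le\theta\le1$,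 such that $$c_1f(t)\le\lambda_\gamma(t)\le c_2f(t)\qquad\text{for all }t\in I.$$ Then for all Borel sets $E,F\subseteq\mathbb{R}^d$ of finite Lebesgue measure, $$\langle T_\gamma\chi_E,\chi_F\rangle=\int_F T_\gamma\chi_E(x)\,dx\ \le\ C\,|E|^{\frac1{p_d}}\,|F|^{\frac1{q_d'}},\qquad (p_d,q_d')=\Big(\frac{d+1}{2},\frac{d(d+1)}{d^2-d+2}\Big),$$ where the constant $C$ depends only on $d$, $C_\gamma$, $c_1$ and $c_2$. -/

import Mathlib

open MeasureTheory
open scoped ENNReal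

noncomputable section

namespace AffineArclength

/-- The torsion `L_γ(t) = det(γ'(t), …, γ^{(d)}(t))`. -/
def torsion {d : ℕ} (γ : ℝ → EuclideanSpace ℝ (Fin d)) (t : ℝ) : ℝ :=
  (Matrix.of fun i j : Fin d => iteratedDeriv ((j : ℕ) + 1) γ t i).det

/-- The density `λ_γ = |L_γ|^{2/(d(d+1))}` of affine arclength. -/
def affineDensity {d : ℕ} (γ : ℝ → EuclideanSpace ℝ (Fin d)) (t : ℝ) : ℝ :=
  |torsion γ t| ^ (2 / ((d : ℝ) * ((d : ℝ) + 1)))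

/-- The map `Φ_γ(t_1, …, t_d) = ∑_{j=1}^d (-1)^j γ(t_j)` (indices are shifted by one in `Fin d`). -/
def altSum {d : ℕ} (γ : ℝ → EuclideanSpace ℝ (Fin d)) (t : EuclideanSpace ℝ (Fin d)) :
    EuclideanSpace ℝ (Fin d) :=
  ∑ j : Fin d, (-1 : ℝ) ^ ((j : ℕ) + 1) • γ (t j)

/-- The Jacobian determinant `J_γ` of `Φ_γ`. -/
def jacobian {d : ℕ} (γ : ℝ → EuclideanSpace ℝ (Fin d)) (t : EuclideanSpace ℝ (Fin d)) : ℝ :=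
  (fderiv ℝ (altSum γ) t).det

/-- The geometric inequality on `I^d` with constant `c`:
`|J_γ(t_1,…,t_d)| ≥ c ∏_j |L_γ(t_j)|^{1/d} ∏_{i<j} |t_j - t_i|`. -/
def GeometricInequality {d : ℕ} (γ : ℝ → EuclideanSpace ℝ (Fin d)) (I : Set ℝ) (c : ℝ) : Prop :=
  ∀ t : EuclideanSpace ℝ (Fin d), (∀ j, t j ∈ I) →
    c * (∏ j : Fin d, |torsion γ (t j)| ^ (1 / (d : ℝ))) *
        (∏ i : Fin d, ∏ j ∈ Finset.Ioi i, |t j - t i|) ≤ |jacobian γ t|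

/-- `f` takes values in `[0, ∞)` on the interval `I` and is log-concave there. -/
def LogConcaveOn (I : Set ℝ) (f : ℝ → ℝ) : Prop :=
  (∀ t ∈ I, 0 ≤ f t) ∧
    ∀ t₁ ∈ I, ∀ t₂ ∈ I, ∀ θ ∈ Set.Icc (0 : ℝ) 1,
      f t₁ ^ θ * f t₂ ^ (1 - θ) ≤ f (θ * t₁ + (1 - θ) * t₂)

/-- The convolution operator `T_γ g(x) = ∫_I g(x - γ(t)) λ_γ(t) dt` on nonnegative functions `g`;
the value may be `∞`. -/
def convOp {d : ℕ} (γ : ℝ → EuclideanSpace ℝ (Fin d)) (I : Set ℝ)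
    (g : EuclideanSpace ℝ (Fin d) → ℝ≥0∞) (x : EuclideanSpace ℝ (Fin d)) : ℝ≥0∞ :=
  ∫⁻ t in I, g (x - γ t) * ENNReal.ofReal (affineDensity γ t)

/-- The pairing `⟨g, h⟩ = ∫ g h` of nonnegative functions on `ℝ^d`. -/
def pairing {d : ℕ} (g h : EuclideanSpace ℝ (Fin d) → ℝ≥0∞) : ℝ≥0∞ :=
  ∫⁻ x, g x * h x

/-- The characteristic function of a set. -/
def charFn {d : ℕ} (S : Set (EuclideanSpace ℝ (Fin d))) : EuclideanSpace ℝ (Fin d) → ℝ≥0∞ :=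
  S.indicator fun _ => 1

end AffineArclength

end

namespace AffineArclength

/-! The proof is Christ's method of refinements, with the mass of affine arclength as the coordinate
on the curve. Put μ = λ_γ dt. The pairs (x, t) with x ∈ E and x + γ(t) ∈ F are the edges of a
bipartite graph of measure K, the quantity to be bounded; the average degree is α = K/|F| at a
vertex of F and β = K/|E| at a vertex of E. A walk of length d starting at y ∈ F ends at y + ∑
(-1)^j γ(t_j), a point of F or of E according to the parity of d. Many walks with a large Jacobian
force the set of endpoints to be large.

Three ingredients make this work. (1) The geometric inequality makes tangent vectors at distinct
points independent, so they form a Chebyshev system. A sign-change argument then shows that the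
endpoint map is injective on each of the d! orderings of the labels (`eq_of_alternating_sum_eq`),
and the area formula gives ∫ |J_γ| ≤ d! |endpoints|. (2) A subgraph is extracted in which walks can
be continued with labels whose mass coordinates are κα apart, and κβ apart for the two labels at
each E-vertex in the interior of the walk (`exists_isBranching`, `exists_paths`). If β < α, an
E-vertex may have too few edges for κα-separation from its incoming label; this is why only κβ is
asked there. (3) Since |L_γ|^{1/d} = λ_γ · λ_γ^{(d-1)/2}, the lower bound for |J_γ| is the density
of μ^d times ∏_{i<j} (λ_γ(t_i) λ_γ(t_j))^{1/2} |t_j - t_i|. Log-concavity bounds each factor below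
by the mass between t_i and t_j, provided that neither tail is too light
(`LogConcaveOn.min_mass_le`); labels near the ends are discarded beforehand.

Multiplying the d(d-1)/2 separations by the d degrees gives an inequality homogeneous of degree
d(d+1)/2 in K, and its root is the claim. -/

/-! ### Chebyshev systems and injectivity of alternating sums -/

/-- Increasing tuples in an interval form a convex, hence connected, set, on which a continuous
nonvanishing determinant cannot change sign. -/
theorem exists_sign_det_of_strictMono {n : ℕ} {I : Set ℝ} (hI : I.OrdConnected)
    {v : ℝ → Fin n → ℝ} (hv : ContinuousOn v I)
    (hne : ∀ u : Fin n → ℝ, StrictMono u → (∀ j, u j ∈ I) →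
      Matrix.det (Matrix.of fun j => v (u j)) ≠ 0) :
    ∃ e : ℝ, ∀ u : Fin n → ℝ, StrictMono u → (∀ j, u j ∈ I) →
      0 < e * Matrix.det (Matrix.of fun j => v (u j)) := by
  set S : Set (Fin n → ℝ) := {u | StrictMono u ∧ ∀ j, u j ∈ I} with hS
  have hconv : Convex ℝ S := by
    rintro x ⟨hx, hxI⟩ y ⟨hy, hyI⟩ a b ha hb hab
    refine ⟨fun i j hij => ?_, fun j => hI.convex (hxI j) (hyI j) ha hb hab⟩
    have h1 := hx hij
    have h2 := hy hij
    simp only [Pi.add_apply, Pi.smul_apply, smul_eq_mul]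
    rcases ha.eq_or_lt with rfl | ha
    · have : b = 1 := by linarith
      subst this; linarith
    · nlinarith [mul_lt_mul_of_pos_left h1 ha, mul_le_mul_of_nonneg_left h2.le hb]
  have hcont : ContinuousOn (fun u : Fin n → ℝ => Matrix.det (Matrix.of fun j => v (u j))) S := by
    rw [continuousOn_iff_continuous_domRestrict]
    refine Continuous.matrix_det ?_
    refine continuous_pi fun j => ?_
    have : ContinuousOn (fun u : Fin n → ℝ => v (u j)) S :=
      hv.comp (continuous_apply j).continuousOn fun u hu => hu.2 j
    exact continuousOn_iff_continuous_domRestrict.1 this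
  by_cases hemp : S.Nonempty
  · obtain ⟨u₀, hu₀⟩ := hemp
    refine ⟨Matrix.det (Matrix.of fun j => v (u₀ j)), fun u hu huI => ?_⟩
    by_contra hneg
    have himg := (hconv.isPreconnected.image _ hcont).ordConnected
    have h0 : (0 : ℝ) ∈ (fun u : Fin n → ℝ => Matrix.det (Matrix.of fun j => v (u j))) '' S := by
      rcases lt_or_gt_of_ne (hne u₀ hu₀.1 hu₀.2) with h | h
      · refine himg.out ⟨u₀, hu₀, rfl⟩ ⟨u, ⟨hu, huI⟩, rfl⟩ ⟨h.le, ?_⟩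
        by_contra h'
        exact hneg (mul_pos_of_neg_of_neg h (not_le.1 h'))
      · refine himg.out ⟨u, ⟨hu, huI⟩, rfl⟩ ⟨u₀, hu₀, rfl⟩ ⟨?_, h.le⟩
        by_contra h'
        exact hneg (mul_pos h (not_le.1 h'))
    obtain ⟨w, hw, hw0⟩ := h0
    exact hne w hw.1 hw.2 hw0
  · exact ⟨1, fun u hu huI => (hemp ⟨u, hu, huI⟩).elim⟩

theorem strictMono_insertNth {n : ℕ} {z : Fin n → ℝ} (hz : StrictMono z) {u : ℝ}
    (hu : ∀ j, z j ≠ u) (k : Fin (n + 1)) (hk : ∀ j : Fin n, z j < u ↔ j.castSucc < k) :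
    StrictMono (Fin.insertNth (α := fun _ => ℝ) k u z) := by
  intro i j hij
  induction i using Fin.succAboveCases k with
  | x =>
    induction j using Fin.succAboveCases k with
    | x => exact (lt_irrefl _ hij).elim
    | p j =>
      simp only [Fin.insertNth_apply_same, Fin.insertNth_apply_succAbove]
      have := (Fin.lt_succAbove_iff_le_castSucc k j).1 hij
      exact lt_of_le_of_ne (not_lt.1 fun h => absurd ((hk j).1 h) (not_lt.2 this)) (hu j).symm
  | p i =>
    induction j using Fin.succAboveCases k with
    | x =>
      simp only [Fin.insertNth_apply_same, Fin.insertNth_apply_succAbove]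
      exact (hk i).2 ((Fin.succAbove_lt_iff_castSucc_lt k i).1 hij)
    | p j =>
      simp only [Fin.insertNth_apply_succAbove]
      exact hz ((Fin.strictMono_succAbove k).lt_iff_lt.1 hij)

/-- The functional is a constant times x ↦ det(x, v(z_0), …, v(z_{n-1})). Moving the row v(u) to its
place in the increasing order is a cycle whose sign is (-1) to the number of z_j below u, and the
sorted determinant has constant sign. -/
theorem exists_functional_sign {n : ℕ} {I : Set ℝ} (hI : I.OrdConnected)
    {v : ℝ → Fin (n + 1) → ℝ} (hv : ContinuousOn v I)
    (hne : ∀ u : Fin (n + 1) → ℝ, StrictMono u → (∀ j, u j ∈ I) →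
      Matrix.det (Matrix.of fun j => v (u j)) ≠ 0)
    (z : Fin n → ℝ) (hz : StrictMono z) (hzI : ∀ j, z j ∈ I) :
    ∃ w : (Fin (n + 1) → ℝ) →ₗ[ℝ] ℝ, ∀ u ∈ I, (∀ j, z j ≠ u) →
      0 < (-1) ^ (Finset.univ.filter fun j => z j < u).card * w (v u) := by
  obtain ⟨e, he⟩ := exists_sign_det_of_strictMono hI hv hne
  refine ⟨e • (Matrix.detRowAlternating (R := ℝ) (n := Fin (n + 1))).toMultilinearMap.toLinearMap
    (Fin.cons 0 fun j => v (z j)) 0, fun u hu hne' => ?_⟩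
  set c := (Finset.univ.filter fun j => z j < u).card with hc
  have hcn : c < n + 1 := by
    refine Nat.lt_succ_of_le ((Finset.card_le_univ _).trans (by simp))
  have hk : ∀ j : Fin n, z j < u ↔ j.castSucc < (⟨c, hcn⟩ : Fin (n + 1)) := by
    intro j
    rw [Fin.lt_def]
    simp only [Fin.val_castSucc]
    constructor
    · intro h
      have : (Finset.Iic j) ⊆ Finset.univ.filter fun j => z j < u := by
        intro i hi
        simp only [Finset.mem_filter, Finset.mem_univ, true_and]
        exact (hz.monotone (Finset.mem_Iic.1 hi)).trans_lt h
      have := Finset.card_le_card this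
      rw [Fin.card_Iic] at this
      omega
    · intro h
      by_contra h'
      have : (Finset.univ.filter fun j => z j < u) ⊆ Finset.Iio j := by
        intro i hi
        simp only [Finset.mem_filter, Finset.mem_univ, true_and] at hi
        rw [Finset.mem_Iio]
        exact hz.lt_iff_lt.1 (hi.trans_le (not_lt.1 h'))
      have := Finset.card_le_card this
      rw [Fin.card_Iio] at this
      omega
  have hsm := strictMono_insertNth hz hne' ⟨c, hcn⟩ hk
  have hpos := he _ hsm (by
    intro j
    induction j using Fin.succAboveCases ⟨c, hcn⟩ with
    | x => simpa using hu
    | p j => simpa using hzI j)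
  have hdet : Matrix.det (Matrix.of fun j =>
      v (Fin.insertNth (α := fun _ => ℝ) (⟨c, hcn⟩ : Fin (n + 1)) u z j)) =
      (-1) ^ c * Matrix.det (Matrix.of (Fin.cons (v u) fun j => v (z j) : Fin (n + 1) → Fin (n + 1) → ℝ)) := by
    have h1 := Matrix.det_permute (⟨c, hcn⟩ : Fin (n + 1)).cycleRange
      (Matrix.of (Fin.cons (v u) fun j => v (z j) : Fin (n + 1) → Fin (n + 1) → ℝ))
    rw [Fin.sign_cycleRange] at h1
    simp only [Units.val_pow_eq_pow_val, Units.val_neg, Units.val_one, Int.cast_pow, Int.cast_neg,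
      Int.cast_one] at h1
    rw [← h1]
    congr 1
    ext i j
    simp only [Matrix.of_apply, Matrix.submatrix_apply, id]
    rw [Fin.cons_apply_cycleRange]
    induction i using Fin.succAboveCases ⟨c, hcn⟩ with
    | x => simp
    | p i => simp
  rw [hdet] at hpos
  have hw : (e • (Matrix.detRowAlternating (R := ℝ) (n := Fin (n + 1))).toMultilinearMap.toLinearMap
    (Fin.cons 0 fun j => v (z j)) 0) (v u) =
      e * Matrix.det (Matrix.of (Fin.cons (v u) fun j => v (z j) : Fin (n + 1) → Fin (n + 1) → ℝ)) := by
    simp only [LinearMap.smul_apply, smul_eq_mul, MultilinearMap.toLinearMap_apply, Fin.update_cons_zero]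
    rfl
  rw [hw]
  calc _ < _ := hpos
    _ = _ := by ring

/-- If Z has fewer than n points, pad it with points of I to the right of M, which exist because I
is open; they do not affect the count for u ≤ M. -/
theorem exists_functional_sign_finset {n : ℕ} {I : Set ℝ} (hI : I.OrdConnected) (hIo : IsOpen I)
    {v : ℝ → Fin (n + 1) → ℝ} (hv : ContinuousOn v I)
    (hne : ∀ u : Fin (n + 1) → ℝ, StrictMono u → (∀ j, u j ∈ I) →
      Matrix.det (Matrix.of fun j => v (u j)) ≠ 0)
    (Z : Finset ℝ) (hZc : Z.card ≤ n) (hZI : ∀ z ∈ Z, z ∈ I) {M : ℝ} (hM : M ∈ I) :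
    ∃ w : (Fin (n + 1) → ℝ) →ₗ[ℝ] ℝ, ∀ u ∈ I, u ≤ M → u ∉ Z →
      0 < (-1) ^ (Z.filter fun z => z < u).card * w (v u) := by
  have hinf : ((I ∩ Set.Ioi M) \ (Z : Set ℝ)).Infinite := by
    refine Set.Infinite.sdiff ?_ Z.finite_toSet
    obtain ⟨ε, hε, hb⟩ := Metric.isOpen_iff.1 hIo M hM
    refine (Set.Ioo_infinite (show M < M + ε by linarith)).mono ?_
    intro x hx
    refine ⟨hb ?_, hx.1⟩
    rw [Metric.mem_ball, Real.dist_eq, abs_lt]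
    constructor <;> linarith [hx.1, hx.2]
  obtain ⟨T, hT, hTc⟩ := hinf.exists_subset_card_eq (n - Z.card)
  have hdisj : Disjoint Z T := by
    rw [Finset.disjoint_right]
    intro x hx
    exact (hT hx).2
  have hcard : (Z ∪ T).card = n := by
    rw [Finset.card_union_of_disjoint hdisj]; omega
  obtain ⟨w, hw⟩ := exists_functional_sign hI hv hne ((Z ∪ T).orderEmbOfFin hcard)
    ((Z ∪ T).orderEmbOfFin hcard).strictMono (fun j => by
      rcases Finset.mem_union.1 ((Z ∪ T).orderEmbOfFin_mem hcard j) with h | h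
      · exact hZI _ h
      · exact (hT h).1.1)
  refine ⟨w, fun u hu huM huZ => ?_⟩
  have huT : u ∉ Z ∪ T := by
    rw [Finset.mem_union, not_or]
    exact ⟨huZ, fun h => absurd (hT h).1.2 (not_lt.2 huM)⟩
  have := hw u hu (fun j hj => huT (hj ▸ (Z ∪ T).orderEmbOfFin_mem hcard j))
  convert this using 3
  symm
  refine Finset.card_bij (fun j _ => (Z ∪ T).orderEmbOfFin hcard j) ?_ ?_ ?_
  · intro j hj
    simp only [Finset.mem_filter, Finset.mem_univ, true_and] at hj ⊢
    refine ⟨?_, hj⟩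
    rcases Finset.mem_union.1 ((Z ∪ T).orderEmbOfFin_mem hcard j) with h | h
    · exact h
    · exact absurd (hj.trans_le huM) (not_lt.2 (le_of_lt (hT h).1.2))
  · intro i _ j _ h
    exact ((Z ∪ T).orderEmbOfFin hcard).injective h
  · intro z hz
    rw [Finset.mem_filter] at hz
    have : z ∈ Set.range ((Z ∪ T).orderEmbOfFin hcard) := by
      rw [Finset.range_orderEmbOfFin]
      exact Finset.mem_coe.2 (Finset.mem_union_left _ hz.1)
    obtain ⟨j, rfl⟩ := this
    exact ⟨j, by simpa using hz.2, rfl⟩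

/-- Z records the sign changes of b_k - a_k. When the sign flips between two successive indices of
disagreement, monotonicity makes the intervals between a_k and b_k non-overlapping, so the left end
of the later one separates them and joins Z. Hence Z has at most m points, m being the last index of
disagreement, and the parity of Z below u reads off the sign of b_k - a_k. -/
theorem exists_sign_change_finset {a b : ℕ → ℝ} (ha : Monotone a) (hb : Monotone b) (n : ℕ) :
    (∀ k < n, a k = b k) ∨ ∃ m < n, a m ≠ b m ∧ (∀ k < n, m < k → a k = b k) ∧
      ∃ Z : Finset ℝ, Z.card ≤ m ∧ (∀ z ∈ Z, z ≤ min (a m) (b m)) ∧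
        (∀ z ∈ Z, ∃ k < n, z = a k ∨ z = b k) ∧
        ∃ e : ℝ, ∀ k ≤ m, ∀ u ∈ Set.Ioo (min (a k) (b k)) (max (a k) (b k)),
          u ∉ Z ∧ 0 < e * (-1) ^ (Z.filter fun z => z < u).card * (b k - a k) := by
  induction n with
  | zero => left; simp
  | succ n ih =>
    by_cases hn : a n = b n
    · rcases ih with h | ⟨m, hm, h1, h2, Z, h3, h4, h5, h6⟩
      · left
        intro k hk
        rcases Nat.lt_succ_iff_lt_or_eq.1 hk with h' | rfl
        exacts [h k h', hn]
      · right
        refine ⟨m, by omega, h1, fun k hk hmk => ?_, Z, h3, h4, fun z hz => ?_, h6⟩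
        · rcases Nat.lt_succ_iff_lt_or_eq.1 hk with h' | rfl
          exacts [h2 k h' hmk, hn]
        · obtain ⟨k, hk, hz⟩ := h5 z hz
          exact ⟨k, by omega, hz⟩
    · right
      refine ⟨n, by omega, hn, fun k hk hk' => by omega, ?_⟩
      rcases ih with h | ⟨m, hm, h1, h2, Z, h3, h4, h5, e, h6⟩
      -- First disagreement: no switching point is needed, and `e` fixes the initial sign.
      · refine ⟨∅, by simp, by simp, by simp, b n - a n, fun k hk u hu => ⟨by simp, ?_⟩⟩
        rcases hk.lt_or_eq with hk | rfl
        · rw [h k hk] at hu; simp at hu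
        · have : b k - a k ≠ 0 := sub_ne_zero.2 (Ne.symm hn)
          simpa using mul_self_pos.2 this
      have hmid : (a m + b m) / 2 ∈ Set.Ioo (min (a m) (b m)) (max (a m) (b m)) := by
        rcases lt_or_gt_of_ne h1 with h | h
        · rw [min_eq_left h.le, max_eq_right h.le]; constructor <;> linarith
        · rw [min_eq_right h.le, max_eq_left h.le]; constructor <;> linarith
      have hfull : ∀ u, min (a m) (b m) < u → (Z.filter fun z => z < u) = Z := by
        intro u hu
        exact Finset.filter_true_of_mem fun z hz => (h4 z hz).trans_lt hu
      have hm6 := (h6 m le_rfl _ hmid).2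
      rw [hfull _ hmid.1] at hm6
      have hmin : min (a m) (b m) ≤ min (a n) (b n) := min_le_min (ha hm.le) (hb hm.le)
      by_cases hs : 0 < (b m - a m) * (b n - a n)
      · refine ⟨Z, by omega, fun z hz => (h4 z hz).trans hmin, fun z hz => ?_, e,
          fun k hk u hu => ?_⟩
        · obtain ⟨k, hk, hz⟩ := h5 z hz
          exact ⟨k, by omega, hz⟩
        rcases le_or_gt k m with hkm | hkm
        · exact h6 k hkm u hu
        rcases hk.lt_or_eq with hk | rfl
        · rw [h2 k hk hkm] at hu; simp at hu
        · have hu1 := hmin.trans_lt hu.1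
          refine ⟨fun hz => absurd (h4 u hz) (not_le.2 hu1), ?_⟩
          rw [hfull u hu1]
          have : 0 < (e * (-1) ^ Z.card * (b m - a m)) * ((b m - a m) * (b k - a k)) :=
            mul_pos hm6 hs
          have h7 : (e * (-1) ^ Z.card * (b m - a m)) * ((b m - a m) * (b k - a k)) =
            (e * (-1) ^ Z.card * (b k - a k)) * (b m - a m) ^ 2 := by ring
          rw [h7] at this
          exact pos_of_mul_pos_left this (sq_nonneg _)
      · have hbm : b m - a m ≠ 0 := sub_ne_zero.2 (Ne.symm h1)
        have hbn : b n - a n ≠ 0 := sub_ne_zero.2 (Ne.symm hn)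
        have hs' : (b m - a m) * (b n - a n) < 0 :=
          lt_of_le_of_ne (not_lt.1 hs) (mul_ne_zero hbm hbn)
        have hmn1 := ha hm.le
        have hmn2 := hb hm.le
        have hsep : max (a m) (b m) ≤ min (a n) (b n) := by
          rcases mul_neg_iff.1 hs' with ⟨h, h'⟩ | ⟨h, h'⟩
          · rw [max_eq_right (by linarith), min_eq_right (by linarith)]; exact hmn2
          · rw [max_eq_left (by linarith), min_eq_left (by linarith)]; exact hmn1
        set z₀ := min (a n) (b n) with hz₀
        have hlt : min (a m) (b m) < z₀ := (hmid.1.trans hmid.2).trans_le hsep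
        have hz₀Z : z₀ ∉ Z := fun hz => absurd (h4 _ hz) (not_le.2 hlt)
        refine ⟨insert z₀ Z, ?_, ?_, ?_, e, fun k hk u hu => ?_⟩
        · rw [Finset.card_insert_of_notMem hz₀Z]; omega
        · intro z hz
          rcases Finset.mem_insert.1 hz with rfl | hz
          · exact le_rfl
          · exact (h4 z hz).trans hlt.le
        · intro z hz
          rcases Finset.mem_insert.1 hz with rfl | hz
          · exact ⟨n, by omega, min_choice _ _⟩
          · obtain ⟨k, hk, hz⟩ := h5 z hz
            exact ⟨k, by omega, hz⟩
        · rcases le_or_gt k m with hkm | hkm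
          · have hu2 : u < z₀ :=
              hu.2.trans_le ((max_le_max (ha hkm) (hb hkm)).trans hsep)
            obtain ⟨h7, h8⟩ := h6 k hkm u hu
            refine ⟨?_, ?_⟩
            · rw [Finset.mem_insert, not_or]
              exact ⟨hu2.ne, h7⟩
            · rw [Finset.filter_insert, if_neg (not_lt.2 hu2.le)]
              exact h8
          rcases hk.lt_or_eq with hk | rfl
          · rw [h2 k hk hkm] at hu; simp at hu
          · refine ⟨?_, ?_⟩
            · rw [Finset.mem_insert, not_or]
              exact ⟨hu.1.ne', fun hz => absurd (h4 u hz) (not_le.2 (hlt.trans hu.1))⟩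
            · rw [Finset.filter_insert, if_pos hu.1, hfull u (hlt.trans hu.1),
                Finset.card_insert_of_notMem hz₀Z]
              have : 0 < (e * (-1) ^ Z.card * (b m - a m)) * -((b m - a m) * (b k - a k)) :=
                mul_pos hm6 (neg_pos.2 hs')
              have h7 : (e * (-1) ^ Z.card * (b m - a m)) * -((b m - a m) * (b k - a k)) =
                (e * (-1) ^ (Z.card + 1) * (b k - a k)) * (b m - a m) ^ 2 := by ring
              rw [h7] at this
              exact pos_of_mul_pos_left this (sq_nonneg _)

/-- Sums of `n + 1` points on a curve determine the points, provided the tangent vectors at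
any `n + 1` distinct points are linearly independent. -/
theorem eq_of_sum_eq_of_monotone {n : ℕ} {I : Set ℝ} (hI : I.OrdConnected) (hIo : IsOpen I)
    {g v : ℝ → Fin (n + 1) → ℝ} (hg : ∀ t ∈ I, HasDerivAt g (v t) t) (hv : ContinuousOn v I)
    (hne : ∀ u : Fin (n + 1) → ℝ, StrictMono u → (∀ j, u j ∈ I) →
      Matrix.det (Matrix.of fun j => v (u j)) ≠ 0)
    {a b : Fin (n + 1) → ℝ} (ha : Monotone a) (hb : Monotone b) (haI : ∀ j, a j ∈ I)
    (hbI : ∀ j, b j ∈ I) (hab : ∑ j, g (a j) = ∑ j, g (b j)) : a = b := by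
  -- Both tuples are continued to monotone sequences on ℕ, constant from index n on.
  set c : ℕ → Fin (n + 1) := fun k => ⟨min k n, by omega⟩ with hc
  have hcm : Monotone c := fun i j hij => by
    simp only [hc, Fin.mk_le_mk]; exact min_le_min_right _ hij
  have hcj : ∀ j : Fin (n + 1), c j = j := fun j => by
    ext; simp only [hc]; omega
  rcases exists_sign_change_finset (ha.comp hcm) (hb.comp hcm) (n + 1) with
    h | ⟨m, hm, h1, h2, Z, h3, h4, h5, e, h6⟩
  · funext j
    have := h j j.2
    simpa [hcj] using this
  exfalso
  have hM : max (a (Fin.last n)) (b (Fin.last n)) ∈ I := by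
    rcases max_choice (a (Fin.last n)) (b (Fin.last n)) with h | h <;> rw [h]
    exacts [haI _, hbI _]
  obtain ⟨w, hw⟩ := exists_functional_sign_finset hI hIo hv hne Z (by omega) (fun z hz => by
    obtain ⟨k, _, hk | hk⟩ := h5 z hz <;> rw [hk]
    exacts [haI _, hbI _]) hM
  have hwc : Continuous w := w.continuous_of_finiteDimensional
  have hdw : ∀ t ∈ I, HasDerivAt (fun t => w (g t)) (w (v t)) t := fun t ht =>
    (w.toContinuousLinearMap.hasFDerivAt.comp_hasDerivAt t (hg t ht))
  -- Between a_k and b_k, both w(v(u)) and e(b_k - a_k) have the sign (-1)^{#(Z below u)}. So every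
  -- index of disagreement contributes positively to a sum that the hypothesis makes zero.
  have key : ∀ k : Fin (n + 1), a k ≠ b k → 0 < e * (w (g (b k)) - w (g (a k))) := by
    intro k hk
    have hkm : (k : ℕ) ≤ m := by
      by_contra h
      have := h2 k k.2 (not_le.1 h)
      simp only [Function.comp, hcj] at this
      exact hk this
    have h7 := h6 k hkm
    simp only [Function.comp, hcj] at h7
    have hsub : Set.Icc (min (a k) (b k)) (max (a k) (b k)) ⊆ I :=
      hI.uIcc_subset (haI k) (hbI k)
    have hder : ∀ u ∈ Set.Ioo (min (a k) (b k)) (max (a k) (b k)),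
        0 < deriv (fun t => e * (b k - a k) * w (g t)) u := by
      intro u hu
      have huI := hsub ⟨hu.1.le, hu.2.le⟩
      rw [((hdw u huI).const_mul _).deriv]
      have huM : u ≤ max (a (Fin.last n)) (b (Fin.last n)) :=
        hu.2.le.trans (max_le_max (ha (Fin.le_last _)) (hb (Fin.le_last _)))
      have h8 := mul_pos (h7 u hu).2 (hw u huI huM (h7 u hu).1)
      have h9 : ((-1 : ℝ) ^ (Z.filter fun z => z < u).card) ^ 2 = 1 := by
        rw [← pow_mul, mul_comm, pow_mul]; simp
      calc (0 : ℝ) < _ := h8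
        _ = e * (b k - a k) * w (v u) * ((-1 : ℝ) ^ (Z.filter fun z => z < u).card) ^ 2 := by ring
        _ = _ := by rw [h9, mul_one]
    have hmono : StrictMonoOn (fun t => e * (b k - a k) * w (g t))
        (Set.Icc (min (a k) (b k)) (max (a k) (b k))) := by
      refine strictMonoOn_of_deriv_pos (convex_Icc _ _) ?_ ?_
      · exact fun t ht => ((hdw t (hsub ht)).const_mul _).continuousAt.continuousWithinAt
      · rw [interior_Icc]; exact hder
    rcases lt_or_gt_of_ne hk with h | h
    · rw [min_eq_left h.le, max_eq_right h.le] at hmono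
      have h10 := hmono (Set.left_mem_Icc.2 h.le) (Set.right_mem_Icc.2 h.le) h
      simp only at h10
      have : 0 < (b k - a k) * (e * (w (g (b k)) - w (g (a k)))) := by linarith
      exact pos_of_mul_pos_right this (by linarith)
    · rw [min_eq_right h.le, max_eq_left h.le] at hmono
      have h10 := hmono (Set.left_mem_Icc.2 h.le) (Set.right_mem_Icc.2 h.le) h
      simp only at h10
      have : 0 < (a k - b k) * (e * (w (g (b k)) - w (g (a k)))) := by linarith
      exact pos_of_mul_pos_right this (by linarith)
  have hsum : ∑ k, e * (w (g (b k)) - w (g (a k))) = 0 := by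
    rw [← Finset.mul_sum, Finset.sum_sub_distrib, ← map_sum, ← map_sum, hab, sub_self, mul_zero]
  have hpos : 0 < ∑ k, e * (w (g (b k)) - w (g (a k))) := by
    refine Finset.sum_pos' (fun k _ => ?_) ⟨⟨m, hm⟩, Finset.mem_univ _, key _ ?_⟩
    · by_cases hk : a k = b k
      · rw [hk]; simp
      · exact (key k hk).le
    · have := h1
      simpa [Function.comp, hcj ⟨m, hm⟩] using this
  exact hpos.ne' hsum

/-- Alternating sums along the curve are injective on each order sector. -/
theorem eq_of_alternating_sum_eq {n : ℕ} {I : Set ℝ} (hI : I.OrdConnected) (hIo : IsOpen I)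
    {g v : ℝ → Fin (n + 1) → ℝ} (hg : ∀ t ∈ I, HasDerivAt g (v t) t) (hv : ContinuousOn v I)
    (hne : ∀ u : Fin (n + 1) → ℝ, StrictMono u → (∀ j, u j ∈ I) →
      Matrix.det (Matrix.of fun j => v (u j)) ≠ 0)
    {p q : Fin (n + 1) → ℝ} (σ : Equiv.Perm (Fin (n + 1))) (hp : StrictMono (p ∘ σ))
    (hq : StrictMono (q ∘ σ)) (hpI : ∀ j, p j ∈ I) (hqI : ∀ j, q j ∈ I)
    (hpq : ∑ j : Fin (n + 1), (-1 : ℝ) ^ ((j : ℕ) + 1) • g (p j) =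
      ∑ j : Fin (n + 1), (-1 : ℝ) ^ ((j : ℕ) + 1) • g (q j)) : p = q := by
  -- Exchanging p and q at the odd indices moves the negative terms across and turns equal
  -- alternating sums into equal plain sums.
  set P : Fin (n + 1) → ℝ := fun j => if Even (j : ℕ) then p j else q j with hP
  set Q : Fin (n + 1) → ℝ := fun j => if Even (j : ℕ) then q j else p j with hQ
  have hPI : ∀ j, P j ∈ I := fun j => by simp only [hP]; split_ifs; exacts [hpI j, hqI j]
  have hQI : ∀ j, Q j ∈ I := fun j => by simp only [hQ]; split_ifs; exacts [hqI j, hpI j]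
  have hsum : ∑ j, g (P j) = ∑ j, g (Q j) := by
    rw [← sub_eq_zero, ← Finset.sum_sub_distrib] at hpq ⊢
    rw [← neg_eq_zero, ← hpq, ← Finset.sum_neg_distrib]
    refine Finset.sum_congr rfl fun j _ => ?_
    simp only [hP, hQ]
    split_ifs with h
    · rw [pow_succ, h.neg_one_pow]; module
    · rw [pow_succ, (Nat.not_even_iff_odd.1 h).neg_one_pow]; module
  have hsort := eq_of_sum_eq_of_monotone hI hIo hg hv hne (Tuple.monotone_sort P)
    (Tuple.monotone_sort Q) (fun j => hPI _) (fun j => hQI _) (by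
      simp only [Function.comp]
      rw [Equiv.sum_comp (Tuple.sort P) fun j => g (P j),
        Equiv.sum_comp (Tuple.sort Q) fun j => g (Q j), hsum])
  obtain ⟨τ, hτ⟩ : ∃ τ : Equiv.Perm (Fin (n + 1)), ∀ j, P j = Q (τ j) := by
    refine ⟨(Tuple.sort P).symm.trans (Tuple.sort Q), fun j => ?_⟩
    have := congrFun hsort ((Tuple.sort P).symm j)
    simpa using this
  have hpinj : Function.Injective p := (Function.Injective.of_comp_iff' p σ.bijective).1 hp.injective
  have hqinj : Function.Injective q := (Function.Injective.of_comp_iff' q σ.bijective).1 hq.injective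
  -- P and Q agree up to a permutation τ. A match of p with p would pair an even index with an odd
  -- one, contrary to injectivity, so each value of p is matched with a value of q.
  have hpr : ∀ j, p j ∈ Set.range q := by
    intro j
    by_cases hj : Even (j : ℕ)
    · have h1 := hτ j
      simp only [hP, hQ, if_pos hj] at h1
      split_ifs at h1 with h
      · exact ⟨_, h1.symm⟩
      · exact absurd (hpinj h1 ▸ hj) h
    · have h1 := hτ (τ.symm j)
      simp only [hP, hQ, Equiv.apply_symm_apply, if_neg hj] at h1
      split_ifs at h1 with h
      · exact absurd (hpinj h1 ▸ h) hj
      · exact ⟨_, h1⟩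
  have hrange : Set.range (p ∘ σ) = Set.range (q ∘ σ) := by
    rw [σ.surjective.range_comp, σ.surjective.range_comp]
    have hsub : Finset.univ.image p ⊆ Finset.univ.image q := by
      intro x hx
      obtain ⟨j, -, rfl⟩ := Finset.mem_image.1 hx
      obtain ⟨i, hi⟩ := hpr j
      exact Finset.mem_image.2 ⟨i, Finset.mem_univ _, hi⟩
    have := Finset.eq_of_subset_of_card_le hsub (by
      rw [Finset.card_image_of_injective _ hpinj, Finset.card_image_of_injective _ hqinj])
    have h2 := congrArg (fun s : Finset ℝ => (s : Set ℝ)) this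
    simpa using h2
  have hcomp := (StrictMono.range_inj hp hq).1 hrange
  funext j
  have := congrFun hcomp (σ.symm j)
  simpa using this

/-! ### The Jacobian and the change of variables -/

theorem hasFDerivAt_altSum {d : ℕ} {γ v : ℝ → EuclideanSpace ℝ (Fin d)}
    {t : EuclideanSpace ℝ (Fin d)} (h : ∀ j, HasDerivAt γ (v (t j)) (t j)) :
    HasFDerivAt (altSum γ) (∑ j : Fin d, (-1 : ℝ) ^ ((j : ℕ) + 1) •
      ((EuclideanSpace.proj j : EuclideanSpace ℝ (Fin d) →L[ℝ] ℝ).smulRight (v (t j)))) t := by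
  unfold altSum
  refine HasFDerivAt.fun_sum fun j _ => ?_
  have h1 : HasFDerivAt (fun s : EuclideanSpace ℝ (Fin d) => s j)
      (EuclideanSpace.proj j : EuclideanSpace ℝ (Fin d) →L[ℝ] ℝ) t :=
    (EuclideanSpace.proj j : EuclideanSpace ℝ (Fin d) →L[ℝ] ℝ).hasFDerivAt
  have h2 := (h j).hasFDerivAt.comp t h1
  have h3 := h2.const_smul ((-1 : ℝ) ^ ((j : ℕ) + 1))
  have h4 : (EuclideanSpace.proj j : EuclideanSpace ℝ (Fin d) →L[ℝ] ℝ).smulRight (v (t j)) =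
      (ContinuousLinearMap.toSpanSingleton ℝ (v (t j))).comp
        (EuclideanSpace.proj j : EuclideanSpace ℝ (Fin d) →L[ℝ] ℝ) := by
    refine ContinuousLinearMap.ext fun s => ?_
    simp
  rw [h4]
  exact h3

/-- The alternating signs only multiply the columns of the derivative by ±1. This identity turns
nonvanishing of the Jacobian into independence of tangent vectors. -/
theorem abs_jacobian_eq {d : ℕ} {γ v : ℝ → EuclideanSpace ℝ (Fin d)}
    {t : EuclideanSpace ℝ (Fin d)} (h : ∀ j, HasDerivAt γ (v (t j)) (t j)) :
    |jacobian γ t| = |Matrix.det (Matrix.of fun j i => v (t j) i)| := by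
  unfold jacobian
  rw [(hasFDerivAt_altSum h).fderiv, ContinuousLinearMap.det,
    ← LinearMap.det_toMatrix (EuclideanSpace.basisFun (Fin d) ℝ).toBasis]
  have : LinearMap.toMatrix (EuclideanSpace.basisFun (Fin d) ℝ).toBasis
      (EuclideanSpace.basisFun (Fin d) ℝ).toBasis
      ((∑ j : Fin d, (-1 : ℝ) ^ ((j : ℕ) + 1) •
      ((EuclideanSpace.proj j : EuclideanSpace ℝ (Fin d) →L[ℝ] ℝ).smulRight (v (t j))) :
        EuclideanSpace ℝ (Fin d) →L[ℝ] EuclideanSpace ℝ (Fin d)) :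
        EuclideanSpace ℝ (Fin d) →ₗ[ℝ] EuclideanSpace ℝ (Fin d)) =
      (Matrix.of fun j i : Fin d => (-1 : ℝ) ^ ((j : ℕ) + 1) *
        (Matrix.of fun j i : Fin d => v (t j) i) j i).transpose := by
    ext i j
    rw [LinearMap.toMatrix_apply]
    simp [Finset.sum_apply, PiLp.single_apply]
  rw [this, Matrix.det_transpose, Matrix.det_mul_column, abs_mul, Finset.abs_prod]
  simp

/-- The image under the alternating sum map of a set of tuples with distinct coordinates
fills a proportion `1 / d!` of the integral of the Jacobian. -/
theorem lintegral_jacobian_le {n : ℕ} {I : Set ℝ} (hI : I.OrdConnected) (hIo : IsOpen I)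
    {γ v : ℝ → EuclideanSpace ℝ (Fin (n + 1))} (hg : ∀ t ∈ I, HasDerivAt γ (v t) t)
    (hv : ContinuousOn v I)
    (hJ : ∀ t : EuclideanSpace ℝ (Fin (n + 1)), (∀ j, t j ∈ I) → Function.Injective t →
      jacobian γ t ≠ 0)
    {Ω T : Set (EuclideanSpace ℝ (Fin (n + 1)))} (hΩ : MeasurableSet Ω)
    (hΩI : ∀ t ∈ Ω, ∀ j, t j ∈ I) (hΩinj : ∀ t ∈ Ω, Function.Injective t)
    (y : EuclideanSpace ℝ (Fin (n + 1))) (hT : ∀ t ∈ Ω, y + altSum γ t ∈ T) :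
    ∫⁻ t in Ω, ENNReal.ofReal |jacobian γ t| ≤ ((n + 1).factorial : ℝ≥0∞) * volume T := by
  -- The order sectors cover Ω because coordinates are distinct. The map is injective on each, so
  -- the area formula applies sector by sector.
  set s : Equiv.Perm (Fin (n + 1)) → Set (EuclideanSpace ℝ (Fin (n + 1))) :=
    fun σ => {t | StrictMono (t ∘ σ)} with hs
  have hsm : ∀ σ, MeasurableSet (s σ) := by
    intro σ
    have : s σ = ⋂ i, ⋂ j, ⋂ (_ : i < j), {t | t (σ i) < t (σ j)} := by
      ext t
      simp only [hs, Set.mem_ofPred_eq, Set.mem_iInter, StrictMono, Function.comp]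
    rw [this]
    refine MeasurableSet.iInter fun i => MeasurableSet.iInter fun j => MeasurableSet.iInter fun _ => ?_
    exact measurableSet_lt (by fun_prop) (by fun_prop)
  have hcov : Ω ⊆ ⋃ σ, (Ω ∩ s σ) := by
    intro t ht
    refine Set.mem_iUnion.2 ⟨Tuple.sort t, ht, ?_⟩
    exact (Tuple.monotone_sort t).strictMono_of_injective
      ((hΩinj t ht).comp (Tuple.sort t).injective)
  have hgO : ∀ t ∈ I, HasDerivAt (fun t => WithLp.ofLp (γ t)) (WithLp.ofLp (v t)) t := by
    intro t ht
    rw [hasDerivAt_pi]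
    intro i
    exact (EuclideanSpace.proj i : EuclideanSpace ℝ (Fin (n + 1)) →L[ℝ] ℝ).hasFDerivAt.comp_hasDerivAt
      t (hg t ht)
  have hvO : ContinuousOn (fun t => WithLp.ofLp (v t)) I :=
    (PiLp.continuous_ofLp 2 _).comp_continuousOn hv
  have hne : ∀ u : Fin (n + 1) → ℝ, StrictMono u → (∀ j, u j ∈ I) →
      Matrix.det (Matrix.of fun j => WithLp.ofLp (v (u j))) ≠ 0 := by
    intro u hu huI
    have := hJ (WithLp.toLp 2 u) huI hu.injective
    rw [← abs_ne_zero, abs_jacobian_eq (fun j => hg _ (huI j)), abs_ne_zero] at this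
    exact this
  have hpiece : ∀ σ, ∫⁻ t in Ω ∩ s σ, ENNReal.ofReal |jacobian γ t| ≤ volume T := by
    intro σ
    have hinj : Set.InjOn (altSum γ) (Ω ∩ s σ) := by
      intro p hp q hq hpq
      have hpq' := congrArg WithLp.ofLp hpq
      have := eq_of_alternating_sum_eq hI hIo hgO hvO hne (p := WithLp.ofLp p) (q := WithLp.ofLp q)
        σ hp.2 hq.2 (hΩI p hp.1) (hΩI q hq.1) (by
          simpa [altSum] using hpq')
      exact (WithLp.ofLp_injective 2) this
    have hder : ∀ t ∈ Ω ∩ s σ, HasFDerivWithinAt (altSum γ) (fderiv ℝ (altSum γ) t) (Ω ∩ s σ) t := by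
      intro t ht
      exact (hasFDerivAt_altSum fun j => hg _ (hΩI t ht.1 j)).differentiableAt.hasFDerivAt.hasFDerivWithinAt
    have := lintegral_abs_det_fderiv_eq_addHaar_image volume (hΩ.inter (hsm σ)) hder hinj
    unfold jacobian
    rw [this]
    calc volume (altSum γ '' (Ω ∩ s σ)) = volume ((fun x => y + x) '' (altSum γ '' (Ω ∩ s σ))) := by
          rw [Set.image_add_left, measure_preimage_add]
      _ ≤ volume T := by
          refine measure_mono ?_
          rintro _ ⟨_, ⟨t, ht, rfl⟩, rfl⟩
          exact hT t ht.1
  calc ∫⁻ t in Ω, ENNReal.ofReal |jacobian γ t|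
      ≤ ∫⁻ t in ⋃ σ, (Ω ∩ s σ), ENNReal.ofReal |jacobian γ t| := lintegral_mono_set hcov
    _ ≤ ∑' σ, ∫⁻ t in Ω ∩ s σ, ENNReal.ofReal |jacobian γ t| := lintegral_iUnion_le _ _
    _ ≤ ∑' _ : Equiv.Perm (Fin (n + 1)), volume T := ENNReal.tsum_le_tsum hpiece
    _ = _ := by
      rw [tsum_fintype, Finset.sum_const, Finset.card_univ, Fintype.card_perm, Fintype.card_fin,
        nsmul_eq_mul]

/-! ### Degrees in the incidence graph and removal of low-degree vertices -/

/-- The measure of the set of edges of `G` at the vertex `x` of the first class. -/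
def degL {X : Type*} (μ : Measure ℝ) (G : Set (X × ℝ)) (x : X) : ℝ≥0∞ :=
  μ {t | (x, t) ∈ G}

/-- The measure of the set of edges of `G` at the vertex `y` of the second class, where the edge
`(x, t)` joins `x` to `x + γ t`. -/
def degR {X : Type*} [Sub X] (μ : Measure ℝ) (γ : ℝ → X) (G : Set (X × ℝ)) (y : X) : ℝ≥0∞ :=
  μ {t | (y - γ t, t) ∈ G}

section Graph

set_option linter.unusedSectionVars false

variable {X : Type*} [AddCommGroup X] [MeasurableSpace X] [MeasurableAdd₂ X] [MeasurableSub₂ X]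
  {ν : Measure X} [SFinite ν] [ν.IsAddRightInvariant] {μ : Measure ℝ}
  {γ : ℝ → X} {G : Set (X × ℝ)}

section SFinite

variable [SFinite μ]

theorem measurable_degL (hG : MeasurableSet G) : Measurable (degL μ G) :=
  measurable_measure_prodMk_left hG

theorem measurableSet_shear (hγ : Measurable γ) (hG : MeasurableSet G) :
    MeasurableSet {p : X × ℝ | (p.1 - γ p.2, p.2) ∈ G} :=
  (by fun_prop : Measurable fun p : X × ℝ => (p.1 - γ p.2, p.2)) hG

theorem measurable_degR (hγ : Measurable γ) (hG : MeasurableSet G) : Measurable (degR μ γ G) :=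
  measurable_measure_prodMk_left (measurableSet_shear hγ hG)

theorem lintegral_degL (hG : MeasurableSet G) : ∫⁻ x, degL μ G x ∂ν = (ν.prod μ) G :=
  (Measure.prod_apply hG).symm

/-- The shear (x, t) ↦ (x + γ(t), t) preserves the product measure, so edges may be counted from
either class. -/
theorem lintegral_degR (hγ : Measurable γ) (hG : MeasurableSet G) :
    ∫⁻ y, degR μ γ G y ∂ν = (ν.prod μ) G := by
  have h1 : ∫⁻ y, degR μ γ G y ∂ν = (ν.prod μ) {p : X × ℝ | (p.1 - γ p.2, p.2) ∈ G} :=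
    (Measure.prod_apply (measurableSet_shear hγ hG)).symm
  rw [h1, Measure.prod_apply_symm (measurableSet_shear hγ hG), Measure.prod_apply_symm hG]
  refine lintegral_congr fun t => ?_
  have : (fun x => (x, t)) ⁻¹' {p : X × ℝ | (p.1 - γ p.2, p.2) ∈ G} =
      (fun x => x + -γ t) ⁻¹' ((fun x => (x, t)) ⁻¹' G) := by
    ext x
    simp [sub_eq_add_neg]
  rw [this, measure_preimage_add_right]

end SFinite

/-- The first T n of measure below b contains all later ones. Thus a vertex loses at most b through
its own low degree, over all stages of the removal together. -/
theorem measure_iUnion_of_antitone_le {T : ℕ → Set ℝ} (hT : Antitone T) (b : ℝ≥0∞) :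
    μ {t | ∃ n, t ∈ T n ∧ μ (T n) < b} ≤ b := by
  classical
  by_cases h : ∃ n, μ (T n) < b
  · refine (measure_mono (t := T (Nat.find h)) ?_).trans (Nat.find_spec h).le
    rintro t ⟨n, hn, hb⟩
    exact hT (Nat.find_min' h hb) hn
  · have : {t | ∃ n, t ∈ T n ∧ μ (T n) < b} = ∅ := by
      ext t
      simp only [Set.mem_ofPred_eq, Set.mem_empty_iff_false, iff_false]
      rintro ⟨n, -, hb⟩
      exact h ⟨n, hb⟩
    rw [this]; simp

variable [IsFiniteMeasure μ]

/-- Iterated removal of the vertices of low degree. -/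
theorem exists_stable_subgraph (hγ : Measurable γ) (hG : MeasurableSet G) {E F : Set X}
    (hE : MeasurableSet E) (hF : MeasurableSet F)
    (hGE : ∀ p ∈ G, p.1 ∈ E) (hGF : ∀ p ∈ G, p.1 + γ p.2 ∈ F) {a b : X → ℝ≥0∞}
    (ha : Measurable a) (hb : Measurable b)
    (hlt : ∫⁻ y in F, a y ∂ν + ∫⁻ x in E, b x ∂ν < (ν.prod μ) G) :
    ∃ G' ⊆ G, MeasurableSet G' ∧ G'.Nonempty ∧ ∀ p ∈ G', b p.1 ≤ degL μ G' p.1 ∧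
      a (p.1 + γ p.2) ≤ degR μ γ G' (p.1 + γ p.2) := by
  set R : Set (X × ℝ) → Set (X × ℝ) := fun H =>
    {p | p ∈ H ∧ b p.1 ≤ degL μ H p.1 ∧ a (p.1 + γ p.2) ≤ degR μ γ H (p.1 + γ p.2)} with hR
  set H : ℕ → Set (X × ℝ) := fun n => R^[n] G with hH
  have hH0 : H 0 = G := rfl
  have hHs : ∀ n, H (n + 1) = R (H n) := fun n => Function.iterate_succ_apply' R n G
  have hmeas : ∀ n, MeasurableSet (H n) := by
    intro n
    induction n with
    | zero => exact hG
    | succ n ih =>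
      rw [hHs]
      refine ih.inter ((measurableSet_le (hb.comp measurable_fst)
        ((measurable_degL ih).comp measurable_fst)).inter ?_)
      have hadd : Measurable fun p : X × ℝ => p.1 + γ p.2 := by fun_prop
      exact measurableSet_le (ha.comp hadd) ((measurable_degR hγ ih).comp hadd)
  have hanti : Antitone H := antitone_nat_of_succ_le fun n => by
    rw [hHs]; exact fun p hp => hp.1
  have hHG : ∀ n, H n ⊆ G := fun n => hanti (Nat.zero_le n)
  -- `LL` and `LR` contain the edges removed because of their first, respectively second, endpoint.
  -- Their measures are at most ∫_E b and ∫_F a, so `hlt` leaves some edge that is never removed.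
  set LL : Set (X × ℝ) := {p | ∃ n, p ∈ H n ∧ degL μ (H n) p.1 < b p.1} with hLL
  set LR : Set (X × ℝ) := {p | ∃ n, p ∈ H n ∧ degR μ γ (H n) (p.1 + γ p.2) < a (p.1 + γ p.2)}
    with hLR
  have hLLm : MeasurableSet LL := by
    have : LL = ⋃ n, (H n ∩ {p | degL μ (H n) p.1 < b p.1}) := by ext p; simp [hLL]
    rw [this]
    exact MeasurableSet.iUnion fun n => (hmeas n).inter
      (measurableSet_lt ((measurable_degL (hmeas n)).comp measurable_fst) (hb.comp measurable_fst))
  have hLRm : MeasurableSet LR := by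
    have : LR = ⋃ n, (H n ∩ {p | degR μ γ (H n) (p.1 + γ p.2) < a (p.1 + γ p.2)}) := by
      ext p; simp [hLR]
    rw [this]
    have hadd : Measurable fun p : X × ℝ => p.1 + γ p.2 := by fun_prop
    exact MeasurableSet.iUnion fun n => (hmeas n).inter
      (measurableSet_lt ((measurable_degR hγ (hmeas n)).comp hadd) (ha.comp hadd))
  have hLL1 : (ν.prod μ) LL ≤ ∫⁻ x in E, b x ∂ν := by
    rw [← lintegral_degL hLLm, ← lintegral_indicator hE]
    refine lintegral_mono fun x => ?_
    by_cases hx : x ∈ E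
    · rw [Set.indicator_of_mem hx]
      exact measure_iUnion_of_antitone_le (T := fun n => {t | (x, t) ∈ H n})
        (fun i j hij t ht => hanti hij ht) (b x)
    · have : {t | (x, t) ∈ LL} = ∅ := by
        ext t
        simp only [Set.mem_ofPred_eq, Set.mem_empty_iff_false, iff_false]
        rintro ⟨n, hn, -⟩
        exact hx (hGE _ (hHG n hn))
      simp [degL, this]
  have hLR1 : (ν.prod μ) LR ≤ ∫⁻ x in F, a x ∂ν := by
    rw [← lintegral_degR hγ hLRm, ← lintegral_indicator hF]
    refine lintegral_mono fun y => ?_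
    by_cases hy : y ∈ F
    · rw [Set.indicator_of_mem hy]
      have := measure_iUnion_of_antitone_le (μ := μ) (T := fun n => {t | (y - γ t, t) ∈ H n})
        (fun i j hij t ht => hanti hij ht) (a y)
      refine le_trans (le_of_eq ?_) this
      simp only [degR, hLR, Set.mem_ofPred_eq, sub_add_cancel]
    · have : {t | (y - γ t, t) ∈ LR} = ∅ := by
        ext t
        simp only [Set.mem_ofPred_eq, Set.mem_empty_iff_false, iff_false]
        rintro ⟨n, hn, -⟩
        have := hGF _ (hHG n hn)
        simp only [sub_add_cancel] at this
        exact hy this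
      simp [degR, this]
  refine ⟨⋂ n, H n, Set.iInter_subset _ 0, MeasurableSet.iInter hmeas, ?_, ?_⟩
  · by_contra hemp
    rw [Set.not_nonempty_iff_eq_empty] at hemp
    have hsub : G ⊆ LR ∪ LL := by
      intro p hp
      by_contra hnot
      have : ∀ n, p ∈ H n := by
        intro n
        induction n with
        | zero => exact hp
        | succ n ih =>
          rw [hHs]
          refine ⟨ih, ?_, ?_⟩
          · by_contra h
            exact hnot (Or.inr ⟨n, ih, not_le.1 h⟩)
          · by_contra h
            exact hnot (Or.inl ⟨n, ih, not_le.1 h⟩)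
      have h2 : p ∈ ⋂ n, H n := Set.mem_iInter.2 this
      rw [hemp] at h2
      exact h2
    refine absurd hlt (not_lt.2 ?_)
    calc (ν.prod μ) G ≤ (ν.prod μ) LR + (ν.prod μ) LL :=
          (measure_mono hsub).trans (measure_union_le _ _)
      _ ≤ _ := add_le_add hLR1 hLL1
  -- The degree bounds at each stage pass to the intersection by continuity from above, which uses
  -- that μ is finite.
  · intro p hp
    have hp' : ∀ n, p ∈ R (H n) := fun n => by
      rw [← hHs]; exact Set.mem_iInter.1 hp (n + 1)
    constructor
    · have h1 : {t | (p.1, t) ∈ ⋂ n, H n} = ⋂ n, {t | (p.1, t) ∈ H n} := by ext t; simp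
      have h2 : Antitone fun n => {t | (p.1, t) ∈ H n} := fun i j hij t ht => hanti hij ht
      rw [degL, h1, h2.measure_iInter
        (fun n => (measurable_prodMk_left (hmeas n)).nullMeasurableSet) ⟨0, measure_ne_top _ _⟩]
      exact le_iInf fun n => (hp' n).2.1
    · have h1 : {t | (p.1 + γ p.2 - γ t, t) ∈ ⋂ n, H n} =
          ⋂ n, {t | (p.1 + γ p.2 - γ t, t) ∈ H n} := by ext t; simp
      have h2 : Antitone fun n => {t | (p.1 + γ p.2 - γ t, t) ∈ H n} :=
        fun i j hij t ht => hanti hij ht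
      rw [degR, h1, h2.measure_iInter
        (fun n => (measurable_prodMk_left (measurableSet_shear hγ (hmeas n))).nullMeasurableSet)
        ⟨0, measure_ne_top _ _⟩]
      exact le_iInf fun n => (hp' n).2.2

end Graph

/-! ### Branching subgraphs -/

/-- Every vertex of the graph `G` has many edges whose labels are separated, with respect to the
coordinate `M`, from a given small set of labels. -/
def IsBranching {X : Type*} [Add X] [Sub X] (μ : Measure ℝ) (γ : ℝ → X) (M : ℝ → ℝ) (d : ℕ)
    (κ α β : ℝ) (G : Set (X × ℝ)) : Prop :=
  ∃ r, κ * α ≤ r ∧ ∀ p ∈ G, ∀ P : Finset ℝ, P.card ≤ d →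
    ENNReal.ofReal (κ * α) ≤ μ {s | (p.1 + γ p.2 - γ s, s) ∈ G ∧ ∀ q ∈ P, r ≤ |M q - M s|} ∧
    ((∀ q ∈ P, r ≤ |M q - M p.2|) → ENNReal.ofReal (κ * β) ≤
      μ {s | (p.1, s) ∈ G ∧ κ * β ≤ |M p.2 - M s| ∧ ∀ q ∈ P, κ * α ≤ |M q - M s|})

/-- Labels with M-coordinate within ρ of a given one have mass at most 2ρ, so avoiding k labels
costs at most 2kρ. -/
theorem le_measure_separated {μ : Measure ℝ} {M : ℝ → ℝ}
    (hM : ∀ u v, μ (M ⁻¹' Set.Icc u v) ≤ ENNReal.ofReal (v - u)) {B : Set ℝ} {P : Finset ℝ}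
    {k : ℕ} (hP : P.card ≤ k) {ρ m : ℝ} (hρ : 0 ≤ ρ) (hm : 0 ≤ m)
    (hB : ENNReal.ofReal (m + 2 * k * ρ) ≤ μ B) :
    ENNReal.ofReal m ≤ μ {s | s ∈ B ∧ ∀ q ∈ P, ρ ≤ |M q - M s|} := by
  have hsub : B ⊆ {s | s ∈ B ∧ ∀ q ∈ P, ρ ≤ |M q - M s|} ∪
      ⋃ q ∈ P, M ⁻¹' Set.Icc (M q - ρ) (M q + ρ) := by
    intro s hs
    by_cases h : ∀ q ∈ P, ρ ≤ |M q - M s|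
    · exact Or.inl ⟨hs, h⟩
    · push Not at h
      obtain ⟨q, hq, hlt⟩ := h
      rw [abs_lt] at hlt
      refine Or.inr (Set.mem_biUnion hq ?_)
      constructor <;> linarith [hlt.1, hlt.2]
  have h1 : μ (⋃ q ∈ P, M ⁻¹' Set.Icc (M q - ρ) (M q + ρ)) ≤ ENNReal.ofReal (2 * k * ρ) := by
    calc _ ≤ ∑ q ∈ P, μ (M ⁻¹' Set.Icc (M q - ρ) (M q + ρ)) := measure_biUnion_finset_le _ _
      _ ≤ ∑ q ∈ P, ENNReal.ofReal (2 * ρ) := by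
        refine Finset.sum_le_sum fun q _ => (hM _ _).trans (ENNReal.ofReal_le_ofReal (by linarith))
      _ = ENNReal.ofReal (P.card * (2 * ρ)) := by
        rw [Finset.sum_const, nsmul_eq_mul,
          ENNReal.ofReal_mul (p := (P.card : ℝ)) (by positivity), ENNReal.ofReal_natCast]
      _ ≤ _ := by
        refine ENNReal.ofReal_le_ofReal ?_
        have : (P.card : ℝ) ≤ k := by exact_mod_cast hP
        nlinarith
  have h2 := hB.trans ((measure_mono hsub).trans (measure_union_le _ _))
  rw [ENNReal.ofReal_add hm (by positivity)] at h2
  exact (ENNReal.add_le_add_iff_right ENNReal.ofReal_ne_top).1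
    (h2.trans (add_le_add_right h1 _))

section Graph

set_option linter.unusedSectionVars false

variable {X : Type*} [AddCommGroup X] [MeasurableSpace X] [MeasurableAdd₂ X] [MeasurableSub₂ X]
  {ν : Measure X} [SFinite ν] [ν.IsAddRightInvariant] {μ : Measure ℝ} [IsFiniteMeasure μ]
  {γ : ℝ → X} {G : Set (X × ℝ)} {M : ℝ → ℝ}

theorem IsBranching.mono {d : ℕ} {κ κ' α β : ℝ} (hα : 0 ≤ α) (hβ : 0 ≤ β) (hκ : κ' ≤ κ)
    (h : IsBranching μ γ M d κ α β G) : IsBranching μ γ M d κ' α β G := by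
  obtain ⟨r, hr, h⟩ := h
  have h1 : κ' * α ≤ κ * α := mul_le_mul_of_nonneg_right hκ hα
  have h2 : κ' * β ≤ κ * β := mul_le_mul_of_nonneg_right hκ hβ
  refine ⟨r, h1.trans hr, fun p hp P hP => ?_⟩
  obtain ⟨h3, h4⟩ := h p hp P hP
  refine ⟨(ENNReal.ofReal_le_ofReal h1).trans h3, fun hq => ?_⟩
  refine ((ENNReal.ofReal_le_ofReal h2).trans (h4 hq)).trans (measure_mono ?_)
  rintro s ⟨h5, h6, h7⟩
  exact ⟨h5, h2.trans h6, fun q hq => h1.trans (h7 q hq)⟩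

/-- For α ≤ β every vertex has room to avoid all earlier labels. Minimal degrees α/4 and β/4 cost
K/2 < 3K/4 edges, and excising the neighbourhoods of earlier labels leaves α/8 and β/8. -/
theorem exists_isBranching_of_le (hM : ∀ u v, μ (M ⁻¹' Set.Icc u v) ≤ ENNReal.ofReal (v - u))
    (hγ : Measurable γ) (hG : MeasurableSet G) {E F : Set X}
    (hE : MeasurableSet E) (hF : MeasurableSet F)
    (hGE : ∀ p ∈ G, p.1 ∈ E) (hGF : ∀ p ∈ G, p.1 + γ p.2 ∈ F) {d : ℕ} (hd : 1 ≤ d)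
    {α β K : ℝ} (hα : 0 < α) (hK : 0 < K) (hαβ : α ≤ β)
    (hαF : ENNReal.ofReal α * ν F = ENNReal.ofReal K)
    (hβE : ENNReal.ofReal β * ν E = ENNReal.ofReal K)
    (hGK : ENNReal.ofReal (3 / 4 * K) ≤ (ν.prod μ) G) :
    ∃ G' ⊆ G, MeasurableSet G' ∧ G'.Nonempty ∧ IsBranching μ γ M d (1 / (32 * d)) α β G' := by
  have hβ : 0 < β := hα.trans_le hαβ
  have hd' : (1 : ℝ) ≤ d := by exact_mod_cast hd
  obtain ⟨G', h1, h2, h3, h4⟩ := exists_stable_subgraph (ν := ν) (μ := μ) hγ hG hE hF hGE hGF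
    (a := fun _ => ENNReal.ofReal (α / 4)) (b := fun _ => ENNReal.ofReal (β / 4))
    measurable_const measurable_const (by
      refine lt_of_lt_of_le ?_ hGK
      rw [setLIntegral_const, setLIntegral_const,
        show α / 4 = (1 / 4) * α by ring, show β / 4 = (1 / 4) * β by ring,
        ENNReal.ofReal_mul (by norm_num), ENNReal.ofReal_mul (by norm_num), mul_assoc, mul_assoc,
        hαF, hβE, ← ENNReal.ofReal_mul (by norm_num), ← ENNReal.ofReal_add (by positivity)
        (by positivity), ENNReal.ofReal_lt_ofReal_iff (by positivity)]
      linarith)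
  refine ⟨G', h1, h2, h3, α / (16 * d), ?_, fun p hp P hP => ⟨?_, fun _ => ?_⟩⟩
  · rw [div_mul_eq_mul_div, one_mul]
    gcongr; norm_num
  · have := le_measure_separated hM (B := {s | (p.1 + γ p.2 - γ s, s) ∈ G'}) hP
      (ρ := α / (16 * d)) (m := α / 8) (by positivity) (by positivity) (by
        refine le_trans (ENNReal.ofReal_le_ofReal ?_) (h4 p hp).2
        field_simp; norm_num)
    refine le_trans (ENNReal.ofReal_le_ofReal ?_) this
    rw [div_mul_eq_mul_div, one_mul]
    gcongr; linarith
  · classical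
    have hP' : (insert p.2 P).card ≤ 2 * d := (Finset.card_insert_le _ _).trans (by omega)
    have := le_measure_separated hM (B := {s | (p.1, s) ∈ G'}) hP'
      (ρ := β / (32 * d)) (m := β / 8) (by positivity) (by positivity) (by
        refine le_trans (ENNReal.ofReal_le_ofReal ?_) (h4 p hp).1
        push_cast
        field_simp; norm_num)
    refine le_trans (ENNReal.ofReal_le_ofReal ?_) (this.trans (measure_mono ?_))
    · rw [div_mul_eq_mul_div, one_mul]
      gcongr; linarith
    · rintro s ⟨hs, hs'⟩
      have h5 : 1 / (32 * (d : ℝ)) * β = β / (32 * d) := by ring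
      refine ⟨hs, ?_, fun q hq => ?_⟩
      · rw [h5]; exact hs' _ (Finset.mem_insert_self _ _)
      · refine le_trans ?_ (hs' _ (Finset.mem_insert_of_mem hq))
        rw [← h5]
        gcongr

end Graph

theorem abs_sub_le_of_floor_div_eq {δ a b : ℝ} (hδ : 0 < δ) (h : ⌊a / δ⌋ = ⌊b / δ⌋) :
    |a - b| ≤ δ := by
  have := Int.abs_sub_lt_one_of_floor_eq_floor h
  rw [← sub_div, abs_div, abs_of_pos hδ, div_lt_one hδ] at this
  exact this.le

theorem floor_div_mem_of_abs_sub_lt {δ a b : ℝ} (hδ : 0 < δ) (h : |a - b| < δ) :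
    ⌊b / δ⌋ ∈ Finset.Icc (⌊a / δ⌋ - 1) (⌊a / δ⌋ + 1) := by
  rw [abs_lt] at h
  have h1 : b / δ < a / δ + 1 := by rw [div_add_one hδ.ne']; gcongr; linarith
  have h2 : a / δ < b / δ + 1 := by rw [div_add_one hδ.ne']; gcongr; linarith
  rw [Finset.mem_Icc]
  constructor
  · have := Int.floor_le_floor h2.le
    rw [Int.floor_add_one] at this
    omega
  · have := Int.floor_le_floor h1.le
    rw [Int.floor_add_one] at this
    omega

section Graph

set_option linter.unusedSectionVars false

variable {X : Type*} [AddCommGroup X] [MeasurableSpace X] [MeasurableAdd₂ X] [MeasurableSub₂ X]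
  {ν : Measure X} [SFinite ν] [ν.IsAddRightInvariant] {μ : Measure ℝ} [IsFiniteMeasure μ]
  {γ : ℝ → X} {G : Set (X × ℝ)} {M : ℝ → ℝ}

/-- Some cell of the partition of the labels into the level sets of `c` carries at least the
proportion `η` of the edges at `x`. -/
def heavySet (μ : Measure ℝ) (G : Set (X × ℝ)) (c : ℝ → ℕ) (η : ℝ) (n : ℕ) : Set X :=
  {x | ENNReal.ofReal η * degL μ G x ≤ degL μ (G ∩ {p | c p.2 = n}) x}

theorem measurableSet_inter_cell (hG : MeasurableSet G) {c : ℝ → ℕ} (hc : Measurable c) (n : ℕ) :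
    MeasurableSet (G ∩ {p | c p.2 = n}) :=
  hG.inter ((hc.comp measurable_snd) (measurableSet_singleton n))

theorem measurableSet_heavySet (hG : MeasurableSet G) {c : ℝ → ℕ} (hc : Measurable c) (η : ℝ)
    (n : ℕ) : MeasurableSet (heavySet μ G c η n) :=
  measurableSet_le ((measurable_degL hG).const_mul _)
    (measurable_degL (measurableSet_inter_cell hG hc n))

/-- If most vertices have a heavy cell, one may restrict the edges at each vertex to one cell. -/
theorem exists_subgraph_of_heavy (hG : MeasurableSet G) {c : ℝ → ℕ} (hc : Measurable c) {η : ℝ} :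
    ∃ G' ⊆ G, MeasurableSet G' ∧
      (∀ p ∈ G', ∀ s, (p.1, s) ∈ G' → c p.2 = c s) ∧
      ENNReal.ofReal η * (ν.prod μ) (G ∩ {p | ∃ n, p.1 ∈ heavySet μ G c η n}) ≤
        (ν.prod μ) G' := by
  classical
  -- Each vertex is assigned to its first heavy cell, which makes the choice measurable.
  set T : ℕ → Set X := fun n => heavySet μ G c η n \ ⋃ m < n, heavySet μ G c η m with hT
  have hTm : ∀ n, MeasurableSet (T n) := fun n =>
    (measurableSet_heavySet hG hc η n).diff (MeasurableSet.biUnion (Set.to_countable _)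
      fun m _ => measurableSet_heavySet hG hc η m)
  have hTu : ∀ x n m, x ∈ T n → x ∈ T m → n = m := by
    intro x n m hn hm
    rcases lt_trichotomy n m with h | h | h
    · exact (hm.2 (Set.mem_biUnion h hn.1)).elim
    · exact h
    · exact (hn.2 (Set.mem_biUnion h hm.1)).elim
  set G' : Set (X × ℝ) := ⋃ n, (G ∩ {p | c p.2 = n} ∩ {p | p.1 ∈ T n}) with hG'
  have hG'm : MeasurableSet G' := MeasurableSet.iUnion fun n =>
    (measurableSet_inter_cell hG hc n).inter (measurable_fst (hTm n))
  have hHm : MeasurableSet (G ∩ {p : X × ℝ | ∃ n, p.1 ∈ heavySet μ G c η n}) := by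
    have : {p : X × ℝ | ∃ n, p.1 ∈ heavySet μ G c η n} =
      Prod.fst ⁻¹' (⋃ n, heavySet μ G c η n) := by ext p; simp
    rw [this]
    exact hG.inter (measurable_fst (MeasurableSet.iUnion fun n => measurableSet_heavySet hG hc η n))
  refine ⟨G', ?_, hG'm, ?_, ?_⟩
  · exact Set.iUnion_subset fun n p hp => hp.1.1
  · intro p hp s hs
    obtain ⟨n, hn⟩ := Set.mem_iUnion.1 hp
    obtain ⟨m, hm⟩ := Set.mem_iUnion.1 hs
    have hnm := hTu p.1 n m hn.2 hm.2
    have h1 : c p.2 = n := hn.1.2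
    have h2 : c s = m := hm.1.2
    rw [h1, h2, hnm]
  · rw [← lintegral_degL hG'm, ← lintegral_degL hHm, ← lintegral_const_mul _ (measurable_degL hHm)]
    refine lintegral_mono fun x => ?_
    by_cases hx : ∃ n, x ∈ heavySet μ G c η n
    · have h1 : x ∈ T (Nat.find hx) := by
        refine ⟨Nat.find_spec hx, ?_⟩
        simp only [Set.mem_iUnion, not_exists]
        exact fun m hm => Nat.find_min hx hm
      have h2 : degL μ (G ∩ {p | ∃ n, p.1 ∈ heavySet μ G c η n}) x ≤ degL μ G x :=
        measure_mono fun s hs => hs.1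
      refine (mul_le_mul_right h2 _).trans ((Nat.find_spec hx).trans (measure_mono ?_))
      intro s hs
      exact Set.mem_iUnion.2 ⟨_, hs, h1⟩
    · have : {t | (x, t) ∈ G ∩ {p : X × ℝ | ∃ n, p.1 ∈ heavySet μ G c η n}} = ∅ := by
        ext t
        simp only [Set.mem_ofPred_eq, Set.mem_empty_iff_false, iff_false]
        exact fun h => hx h.2
      have h0 : degL μ (G ∩ {p : X × ℝ | ∃ n, p.1 ∈ heavySet μ G c η n}) x = 0 := by
        unfold degL; rw [this]; exact measure_empty
      rw [h0, mul_zero]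
      exact zero_le

/-- The labels at a first-class vertex all lie in one cell of length κα. Hence if the incoming label
is 2κα away from the earlier ones, every outgoing label is κα away from them without any excision;
only the incoming label itself has to be avoided, at distance κβ. -/
theorem exists_isBranching_of_cells
    (hM : ∀ u v, μ (M ⁻¹' Set.Icc u v) ≤ ENNReal.ofReal (v - u))
    (hγ : Measurable γ) (hG : MeasurableSet G) {E F : Set X}
    (hE : MeasurableSet E) (hF : MeasurableSet F)
    (hGE : ∀ p ∈ G, p.1 ∈ E) (hGF : ∀ p ∈ G, p.1 + γ p.2 ∈ F) {d : ℕ} (hd : 1 ≤ d)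
    {α β K η : ℝ} (hα : 0 < α) (hβ : 0 < β) (hη : 0 < η) (hK : 0 < K)
    (hαF : ENNReal.ofReal α * ν F = ENNReal.ofReal K)
    (hβE : ENNReal.ofReal β * ν E = ENNReal.ofReal K)
    (hGK : ENNReal.ofReal (3 / 8 * η * K) ≤ (ν.prod μ) G)
    (hcell : ∀ p ∈ G, ∀ s, (p.1, s) ∈ G → |M p.2 - M s| ≤ η * α / (64 * d)) :
    ∃ G' ⊆ G, MeasurableSet G' ∧ G'.Nonempty ∧ IsBranching μ γ M d (η / (64 * d)) α β G' := by
  have hd' : (1 : ℝ) ≤ d := by exact_mod_cast hd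
  obtain ⟨G', h1, h2, h3, h4⟩ := exists_stable_subgraph (ν := ν) (μ := μ) hγ hG hE hF hGE hGF
    (a := fun _ => ENNReal.ofReal (η / 8 * α)) (b := fun _ => ENNReal.ofReal (η / 8 * β))
    measurable_const measurable_const (by
      refine lt_of_lt_of_le ?_ hGK
      rw [setLIntegral_const, setLIntegral_const,
        ENNReal.ofReal_mul (by positivity), ENNReal.ofReal_mul (by positivity), mul_assoc,
        mul_assoc, hαF, hβE, ← ENNReal.ofReal_mul (by positivity), ← ENNReal.ofReal_add
        (by positivity) (by positivity), ENNReal.ofReal_lt_ofReal_iff (by positivity)]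
      nlinarith [mul_pos hη hK])
  -- The witness r is twice the cell length.
  refine ⟨G', h1, h2, h3, η * α / (32 * d), ?_, fun p hp P hP => ⟨?_, fun hq => ?_⟩⟩
  · rw [div_mul_eq_mul_div]
    gcongr; norm_num
  · have := le_measure_separated hM (B := {s | (p.1 + γ p.2 - γ s, s) ∈ G'}) hP
      (ρ := η * α / (32 * d)) (m := η * α / 16) (by positivity) (by positivity) (by
        refine le_trans (ENNReal.ofReal_le_ofReal ?_) (h4 p hp).2
        field_simp; norm_num)
    refine le_trans (ENNReal.ofReal_le_ofReal ?_) this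
    rw [div_mul_eq_mul_div]
    gcongr; linarith
  · have := le_measure_separated hM (B := {s | (p.1, s) ∈ G'}) (P := {p.2}) (k := 1) (by simp)
      (ρ := η * β / 32) (m := η * β / 16) (by positivity) (by positivity) (by
        refine le_trans (ENNReal.ofReal_le_ofReal ?_) (h4 p hp).1
        push_cast
        linarith)
    refine le_trans (ENNReal.ofReal_le_ofReal ?_) (this.trans (measure_mono ?_))
    · rw [div_mul_eq_mul_div]
      gcongr; linarith
    · rintro s ⟨hs, hs'⟩
      refine ⟨hs, le_trans ?_ (hs' p.2 (Finset.mem_singleton_self _)), fun q hq' => ?_⟩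
      · rw [div_mul_eq_mul_div]
        gcongr; linarith
      · have h5 := hcell p (h1 hp) s (h1 hs)
        have h6 := hq q hq'
        have h7 := abs_sub_le (M q) (M s) (M p.2)
        rw [abs_sub_comm (M s)] at h7
        have h8 : η * α / (32 * d) = 2 * (η * α / (64 * d)) := by field_simp; norm_num
        have h9 : η / (64 * d) * α = η * α / (64 * d) := by ring
        linarith

/-- No cell carries more than the share η of the degree of a vertex. The labels within δ of d + 1 ≤
2d given ones lie in at most 6d cells, which carry at most 6dη = 1/16 of that degree, so they can be
excised even though β may be far smaller than δ. -/
theorem exists_isBranching_of_light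
    (hM : ∀ u v, μ (M ⁻¹' Set.Icc u v) ≤ ENNReal.ofReal (v - u))
    (hγ : Measurable γ) {G₀ : Set (X × ℝ)} (hG₀ : MeasurableSet G₀) (hG : MeasurableSet G)
    (hGG₀ : G ⊆ G₀) {E F : Set X}
    (hE : MeasurableSet E) (hF : MeasurableSet F)
    (hGE : ∀ p ∈ G, p.1 ∈ E) (hGF : ∀ p ∈ G, p.1 + γ p.2 ∈ F) {d : ℕ} (hd : 1 ≤ d)
    {α β K η δ : ℝ} (hα : 0 < α) (hβ : 0 < β) (hβα : β ≤ α) (hK : 0 < K) (hδ : 0 < δ)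
    (hη : η = 1 / (96 * d))
    (hαF : ENNReal.ofReal α * ν F = ENNReal.ofReal K)
    (hβE : ENNReal.ofReal β * ν E = ENNReal.ofReal K)
    (hGK : ENNReal.ofReal (3 / 8 * K) ≤ (ν.prod μ) G)
    (hG₀K : (ν.prod μ) G₀ ≤ ENNReal.ofReal K)
    (hδα : δ = η * α / (64 * d))
    (hlight : ∀ p ∈ G, ∀ n : ℤ, degL μ (G₀ ∩ {q | ⌊M q.2 / δ⌋ = n}) p.1 ≤
      ENNReal.ofReal η * degL μ G₀ p.1) :
    ∃ G' ⊆ G, MeasurableSet G' ∧ G'.Nonempty ∧ IsBranching μ γ M d (η / (64 * d)) α β G' := by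
  classical
  have hd' : (1 : ℝ) ≤ d := by exact_mod_cast hd
  have hη0 : 0 < η := by rw [hη]; positivity
  have hη1 : η ≤ 1 := by
    rw [hη, div_le_one (by positivity)]; linarith
  obtain ⟨G', h1, h2, h3, h4⟩ := exists_stable_subgraph (ν := ν) (μ := μ) hγ hG hE hF hGE hGF
    (a := fun _ => ENNReal.ofReal (1 / 8 * α))
    -- The threshold depends on the vertex: its second term pays for the cells to be excised, and
    -- β/16 remains.
    (b := fun x => ENNReal.ofReal (1 / 16 * β) + ENNReal.ofReal (1 / 16) * degL μ G₀ x)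
    measurable_const (by have := measurable_degL (μ := μ) hG₀; fun_prop) (by
      refine lt_of_lt_of_le ?_ hGK
      have h5 : ∫⁻ x in E, ENNReal.ofReal (1 / 16) * degL μ G₀ x ∂ν ≤ ENNReal.ofReal (1 / 16 * K) := by
        rw [lintegral_const_mul _ (measurable_degL hG₀), ENNReal.ofReal_mul (by norm_num)]
        gcongr
        exact (setLIntegral_le_lintegral _ _).trans ((lintegral_degL hG₀).le.trans hG₀K)
      rw [lintegral_add_left measurable_const]
      refine lt_of_le_of_lt (add_le_add_right (add_le_add_right h5 _) _) ?_
      rw [setLIntegral_const, setLIntegral_const,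
        ENNReal.ofReal_mul (by positivity), ENNReal.ofReal_mul (by positivity), mul_assoc,
        mul_assoc, hαF, hβE, ← ENNReal.ofReal_mul (by positivity), ← ENNReal.ofReal_mul
        (by positivity), ← ENNReal.ofReal_add (by positivity) (by positivity),
        ← ENNReal.ofReal_add (by positivity) (by positivity),
        ENNReal.ofReal_lt_ofReal_iff (by positivity)]
      linarith)
  have hκ : η / (64 * d) * α = δ := by rw [hδα]; ring
  have hηd : η / (64 * d) ≤ 1 / 64 := by
    rw [div_le_div_iff₀ (by positivity) (by positivity)]; nlinarith
  refine ⟨G', h1, h2, h3, α / (32 * d), ?_, fun p hp P hP => ⟨?_, fun _ => ?_⟩⟩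
  · rw [div_mul_eq_mul_div, div_le_div_iff₀ (by positivity) (by positivity)]
    nlinarith [mul_le_of_le_one_left hα.le hη1, mul_pos hα (zero_lt_one.trans_le hd')]
  · have := le_measure_separated hM (B := {s | (p.1 + γ p.2 - γ s, s) ∈ G'}) hP
      (ρ := α / (32 * d)) (m := α / 16) (by positivity) (by positivity) (by
        refine le_trans (ENNReal.ofReal_le_ofReal ?_) (h4 p hp).2
        field_simp; norm_num)
    refine le_trans (ENNReal.ofReal_le_ofReal ?_) this
    nlinarith
  · set P' := insert p.2 P with hP'
    have hP'c : P'.card ≤ 2 * d := (Finset.card_insert_le _ _).trans (by omega)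
    set N : Finset ℤ := P'.biUnion fun q => Finset.Icc (⌊M q / δ⌋ - 1) (⌊M q / δ⌋ + 1) with hN
    have hNc : N.card ≤ 6 * d := by
      refine Finset.card_biUnion_le.trans ?_
      have : ∀ q ∈ P', (Finset.Icc (⌊M q / δ⌋ - 1) (⌊M q / δ⌋ + 1)).card ≤ 3 := by
        intro q _
        rw [Int.card_Icc]; omega
      refine (Finset.sum_le_card_nsmul _ _ _ this).trans ?_
      simp only [smul_eq_mul]; omega
    have hbad : μ (⋃ n ∈ N, {s | (p.1, s) ∈ G₀ ∩ {q | ⌊M q.2 / δ⌋ = n}}) ≤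
        ENNReal.ofReal (1 / 16) * degL μ G₀ p.1 := by
      refine (measure_biUnion_finset_le _ _).trans ?_
      refine (Finset.sum_le_card_nsmul _ _ _ fun n _ => hlight p (h1 hp) n).trans ?_
      rw [nsmul_eq_mul, ← mul_assoc]
      gcongr
      rw [← ENNReal.ofReal_natCast, ← ENNReal.ofReal_mul (by positivity)]
      refine ENNReal.ofReal_le_ofReal ?_
      have : (N.card : ℝ) ≤ 6 * d := by exact_mod_cast hNc
      calc (N.card : ℝ) * η ≤ 6 * d * η := by gcongr
        _ = 1 / 16 := by rw [hη]; field_simp; norm_num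
    have hsub : {s | (p.1, s) ∈ G'} ⊆ {s | (p.1, s) ∈ G' ∧ ∀ q ∈ P', δ ≤ |M q - M s|} ∪
        ⋃ n ∈ N, {s | (p.1, s) ∈ G₀ ∩ {q | ⌊M q.2 / δ⌋ = n}} := by
      intro s hs
      by_cases h : ∀ q ∈ P', δ ≤ |M q - M s|
      · exact Or.inl ⟨hs, h⟩
      · push Not at h
        obtain ⟨q, hq, hlt⟩ := h
        refine Or.inr (Set.mem_biUnion (x := ⌊M s / δ⌋) ?_ ⟨hGG₀ (h1 hs), rfl⟩)
        exact Finset.mem_coe.2 (Finset.mem_biUnion.2 ⟨q, hq, floor_div_mem_of_abs_sub_lt hδ hlt⟩)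
    have h5 := ((h4 p hp).1.trans (measure_mono hsub)).trans (measure_union_le _ _)
    have h6 : ENNReal.ofReal (1 / 16) * degL μ G₀ p.1 ≠ ∞ :=
      ENNReal.mul_ne_top ENNReal.ofReal_ne_top (measure_ne_top _ _)
    have h7 := (ENNReal.add_le_add_iff_right h6).1 (h5.trans (add_le_add_right hbad _))
    refine le_trans (ENNReal.ofReal_le_ofReal ?_) (h7.trans (measure_mono ?_))
    · nlinarith
    · rintro s ⟨hs, hs'⟩
      refine ⟨hs, ?_, fun q hq => ?_⟩
      · refine le_trans ?_ (hs' _ (Finset.mem_insert_self _ _))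
        rw [← hκ]; gcongr
      · rw [hκ]; exact hs' _ (Finset.mem_insert_of_mem hq)

/-- Every graph contains a branching subgraph. -/
theorem exists_isBranching (hM : ∀ u v, μ (M ⁻¹' Set.Icc u v) ≤ ENNReal.ofReal (v - u))
    (hMm : Measurable M) (hγ : Measurable γ) (hG : MeasurableSet G) {E F : Set X}
    (hE : MeasurableSet E) (hF : MeasurableSet F)
    (hGE : ∀ p ∈ G, p.1 ∈ E) (hGF : ∀ p ∈ G, p.1 + γ p.2 ∈ F) {d : ℕ} (hd : 1 ≤ d)
    {α β K : ℝ} (hα : 0 < α) (hβ : 0 < β) (hK : 0 < K)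
    (hαF : ENNReal.ofReal α * ν F = ENNReal.ofReal K)
    (hβE : ENNReal.ofReal β * ν E = ENNReal.ofReal K)
    (hGK : ENNReal.ofReal (3 / 4 * K) ≤ (ν.prod μ) G)
    (hGK' : (ν.prod μ) G ≤ ENNReal.ofReal K) :
    ∃ G' ⊆ G, MeasurableSet G' ∧ G'.Nonempty ∧
      IsBranching μ γ M d (1 / (6144 * d ^ 2)) α β G' := by
  have hd' : (1 : ℝ) ≤ d := by exact_mod_cast hd
  rcases le_total α β with hαβ | hβα
  · obtain ⟨G', h1, h2, h3, h4⟩ := exists_isBranching_of_le hM hγ hG hE hF hGE hGF hd hα hK hαβ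
      hαF hβE hGK
    refine ⟨G', h1, h2, h3, h4.mono hα.le hβ.le ?_⟩
    gcongr
    · norm_num
    · nlinarith
  set η : ℝ := 1 / (96 * d) with hη
  set δ : ℝ := η * α / (64 * d) with hδ
  have hη0 : 0 < η := by positivity
  have hδ0 : 0 < δ := by positivity
  have hκ : η / (64 * d) = 1 / (6144 * d ^ 2) := by rw [hη]; field_simp; norm_num
  rw [← hκ]
  -- Cells of length δ = κα, numbered by ℕ so that a vertex has a first heavy cell.
  set c : ℝ → ℕ := fun s => Equiv.intEquivNat ⌊M s / δ⌋ with hc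
  have hcm : Measurable c :=
    (measurable_from_top (f := Equiv.intEquivNat)).comp (Int.measurable_floor.comp (hMm.div_const δ))
  set S : Set (X × ℝ) := {p | ∃ n, p.1 ∈ heavySet μ G c η n} with hS
  have hSm : MeasurableSet S := by
    have : S = Prod.fst ⁻¹' (⋃ n, heavySet μ G c η n) := by ext p; simp [hS]
    rw [this]
    exact measurable_fst (MeasurableSet.iUnion fun n => measurableSet_heavySet hG hcm η n)
  have hsplit : (ν.prod μ) (G ∩ S) + (ν.prod μ) (G \ S) = (ν.prod μ) G :=
    measure_inter_add_sdiff G hSm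
  -- At least half of the guaranteed 3K/4 sits either at vertices with a heavy cell or at vertices
  -- without one.
  by_cases hcase : ENNReal.ofReal (3 / 8 * K) ≤ (ν.prod μ) (G ∩ S)
  · obtain ⟨G₁, h1, h2, h3, h4⟩ := exists_subgraph_of_heavy (ν := ν) (μ := μ) hG hcm (η := η)
    obtain ⟨G', h5, h6, h7, h8⟩ := exists_isBranching_of_cells hM hγ h2 hE hF
      (fun p hp => hGE p (h1 hp)) (fun p hp => hGF p (h1 hp)) hd hα hβ hη0 hK hαF hβE (by
        refine le_trans ?_ h4
        rw [show 3 / 8 * η * K = η * (3 / 8 * K) by ring, ENNReal.ofReal_mul hη0.le]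
        gcongr) (fun p hp s hs =>
        abs_sub_le_of_floor_div_eq hδ0 (Equiv.intEquivNat.injective (h3 p hp s hs)))
    exact ⟨G', h5.trans h1, h6, h7, h8⟩
  · have hlarge : ENNReal.ofReal (3 / 8 * K) ≤ (ν.prod μ) (G \ S) := by
      by_contra hlt
      have h9 := ENNReal.add_lt_add (not_le.1 hcase) (not_le.1 hlt)
      rw [hsplit, ← ENNReal.ofReal_add (by positivity) (by positivity)] at h9
      refine absurd hGK (not_le.2 (h9.trans_le (ENNReal.ofReal_le_ofReal (by linarith))))
    obtain ⟨G', h5, h6, h7, h8⟩ := exists_isBranching_of_light hM hγ hG (hG.diff hSm)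
      Set.sdiff_subset hE hF (fun p hp => hGE p hp.1) (fun p hp => hGF p hp.1) hd hα hβ hβα hK hδ0
      hη hαF hβE hlarge hGK' hδ (fun p hp n => by
        have h10 : p.1 ∉ heavySet μ G c η (Equiv.intEquivNat n) := fun h => hp.2 ⟨_, h⟩
        have h11 : degL μ (G ∩ {p | c p.2 = Equiv.intEquivNat n}) p.1 ≤
            ENNReal.ofReal η * degL μ G p.1 := (lt_of_not_ge h10).le
        simpa only [hc, EmbeddingLike.apply_eq_iff_eq] using h11)
    exact ⟨G', h5.trans Set.sdiff_subset, h6, h7, h8⟩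

end Graph

/-! ### Walks in a branching graph -/

/-- Tuples built one coordinate at a time, the `n`-th coordinate `t` being subject to the
condition `Q n p t` depending on the tuple `p` of the previous ones. -/
def pathSet (Q : ∀ n : ℕ, (Fin n → ℝ) → ℝ → Prop) : ∀ n : ℕ, Set (Fin n → ℝ)
  | 0 => Set.univ
  | n + 1 => {p | Fin.init p ∈ pathSet Q n ∧ Q n (Fin.init p) (p (Fin.last n))}

theorem measurable_init {n : ℕ} : Measurable (Fin.init : (Fin (n + 1) → ℝ) → Fin n → ℝ) :=
  measurable_pi_lambda _ fun i => measurable_pi_apply (Fin.castSucc i)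

theorem measurableSet_pathSet {Q : ∀ n : ℕ, (Fin n → ℝ) → ℝ → Prop}
    (hQ : ∀ n, MeasurableSet {x : (Fin n → ℝ) × ℝ | Q n x.1 x.2}) (n : ℕ) :
    MeasurableSet (pathSet Q n) := by
  induction n with
  | zero => exact MeasurableSet.univ
  | succ n ih =>
    have h1 : MeasurableSet (Fin.init ⁻¹' pathSet Q n : Set (Fin (n + 1) → ℝ)) :=
      measurable_init ih
    have h2 : Measurable fun p : Fin (n + 1) → ℝ => (Fin.init p, p (Fin.last n)) :=
      measurable_init.prodMk (measurable_pi_apply _)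
    exact h1.inter (h2 (hQ n))

theorem lintegral_fin_succ {n : ℕ} {f : (Fin (n + 1) → ℝ) → ℝ≥0∞} (hf : Measurable f) :
    ∫⁻ p, f p = ∫⁻ q : Fin n → ℝ, ∫⁻ t : ℝ, f (Fin.snoc q t) := by
  have hmp := (volume_preserving_piFinSuccAbove (fun _ : Fin (n + 1) => ℝ) (Fin.last n)).symm
  rw [← hmp.lintegral_comp_emb (MeasurableEquiv.measurableEmbedding _), Measure.volume_eq_prod,
    lintegral_prod_symm]
  · refine lintegral_congr fun q => lintegral_congr fun t => ?_
    congr 1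
    exact Fin.insertNth_last' _ _
  · exact (hf.comp (MeasurableEquiv.measurable _)).aemeasurable

/-- Tonelli in the last coordinate: every admissible prefix of length n has extensions of mass at
least c n. -/
theorem prod_le_lintegral_pathSet {Q : ∀ n : ℕ, (Fin n → ℝ) → ℝ → Prop}
    (hQ : ∀ n, MeasurableSet {x : (Fin n → ℝ) × ℝ | Q n x.1 x.2}) {w : ℝ → ℝ≥0∞}
    (hw : Measurable w) {c : ℕ → ℝ≥0∞} {N : ℕ}
    (hc : ∀ n < N, ∀ p ∈ pathSet Q n, c n ≤ (volume.withDensity w) {t | Q n p t}) :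
    ∀ n ≤ N, ∏ i ∈ Finset.range n, c i ≤ ∫⁻ p in pathSet Q n, ∏ i, w (p i) := by
  intro n
  induction n with
  | zero =>
    intro _
    simp [pathSet, volume_pi]
  | succ n ih =>
    intro hn
    have hm := measurableSet_pathSet hQ
    have hpr : ∀ k, Measurable fun p : Fin k → ℝ => ∏ i, w (p i) := fun k =>
      Finset.measurable_fun_prod _ fun i _ => hw.comp (measurable_pi_apply i)
    rw [← lintegral_indicator (hm _), lintegral_fin_succ ((hpr _).indicator (hm _)),
      Finset.prod_range_succ]
    have hQq : ∀ q : Fin n → ℝ, MeasurableSet {t | Q n q t} := fun q =>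
      measurable_prodMk_left (hQ n)
    calc (∏ i ∈ Finset.range n, c i) * c n
        ≤ (∫⁻ p in pathSet Q n, ∏ i, w (p i)) * c n := by gcongr; exact ih (by omega)
      _ = ∫⁻ p in pathSet Q n, (∏ i, w (p i)) * c n := (lintegral_mul_const _ (hpr n)).symm
      _ = ∫⁻ q, (pathSet Q n).indicator (fun p => (∏ i, w (p i)) * c n) q :=
        (lintegral_indicator (hm n) _).symm
      _ ≤ _ := ?_
    refine lintegral_mono fun q => ?_
    by_cases hq : q ∈ pathSet Q n
    · rw [Set.indicator_of_mem hq]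
      calc (∏ i, w (q i)) * c n ≤ (∏ i, w (q i)) * (volume.withDensity w) {t | Q n q t} := by
            gcongr; exact hc n (by omega) q hq
        _ = ∫⁻ t, (∏ i, w (q i)) * {t | Q n q t}.indicator w t := by
          rw [withDensity_apply _ (hQq q), ← lintegral_indicator (hQq q),
            lintegral_const_mul _ (hw.indicator (hQq q))]
        _ ≤ _ := by
          refine lintegral_mono fun t => ?_
          by_cases ht : Q n q t
          · rw [Set.indicator_of_mem (by exact ht), Set.indicator_of_mem]
            · rw [Fin.prod_univ_castSucc]
              simp
            · exact ⟨by simpa using hq, by simpa using ht⟩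
          · rw [Set.indicator_of_notMem (by exact ht), mul_zero]
            exact zero_le
    · rw [Set.indicator_of_notMem hq]
      exact zero_le

variable {m : ℕ}

/-- The endpoint of the path with the given starting point and labels. -/
def pathEnd (γ : ℝ → EuclideanSpace ℝ (Fin m)) (y : EuclideanSpace ℝ (Fin m)) (n : ℕ)
    (p : Fin n → ℝ) : EuclideanSpace ℝ (Fin m) :=
  y + ∑ k : Fin n, (-1 : ℝ) ^ ((k : ℕ) + 1) • γ (p k)

theorem pathEnd_succ (γ : ℝ → EuclideanSpace ℝ (Fin m)) (y : EuclideanSpace ℝ (Fin m)) (n : ℕ)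
    (p : Fin (n + 1) → ℝ) :
    pathEnd γ y (n + 1) p =
      pathEnd γ y n (Fin.init p) + (-1 : ℝ) ^ (n + 1) • γ (p (Fin.last n)) := by
  simp only [pathEnd, Fin.sum_univ_castSucc, Fin.init, add_assoc, Fin.val_castSucc, Fin.val_last]

/-- Paths in the graph `G` alternating between its two classes, with separated labels. -/
def pathStep (γ : ℝ → EuclideanSpace ℝ (Fin m)) (M : ℝ → ℝ)
    (G : Set (EuclideanSpace ℝ (Fin m) × ℝ)) (r a b : ℝ) (y : EuclideanSpace ℝ (Fin m))
    (n : ℕ) (p : Fin n → ℝ) (t : ℝ) : Prop :=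
  if Even n then (pathEnd γ y n p - γ t, t) ∈ G ∧ ∀ k, r ≤ |M (p k) - M t|
  else (pathEnd γ y n p, t) ∈ G ∧
    ∀ k : Fin n, (if (k : ℕ) + 1 = n then b else a) ≤ |M (p k) - M t|

theorem measurableSet_pathStep {γ : ℝ → EuclideanSpace ℝ (Fin m)} (hγ : Measurable γ)
    {M : ℝ → ℝ} (hM : Measurable M) {G : Set (EuclideanSpace ℝ (Fin m) × ℝ)}
    (hG : MeasurableSet G) (r a b : ℝ) (y : EuclideanSpace ℝ (Fin m)) (n : ℕ) :
    MeasurableSet {x : (Fin n → ℝ) × ℝ | pathStep γ M G r a b y n x.1 x.2} := by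
  have h1 : Measurable fun x : (Fin n → ℝ) × ℝ => pathEnd γ y n x.1 := by
    unfold pathEnd
    fun_prop
  have h2 : ∀ k : Fin n, Measurable fun x : (Fin n → ℝ) × ℝ => |M (x.1 k) - M x.2| := by
    intro k
    have : Measurable fun x : (Fin n → ℝ) × ℝ => M (x.1 k) - M x.2 := by fun_prop
    exact this.abs
  have h3 : ∀ c : Fin n → ℝ,
      MeasurableSet {x : (Fin n → ℝ) × ℝ | ∀ k, c k ≤ |M (x.1 k) - M x.2|} := by
    intro c
    have : {x : (Fin n → ℝ) × ℝ | ∀ k, c k ≤ |M (x.1 k) - M x.2|} =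
      ⋂ k, {x | c k ≤ |M (x.1 k) - M x.2|} := by ext x; simp
    rw [this]
    exact MeasurableSet.iInter fun k => measurableSet_le measurable_const (h2 k)
  unfold pathStep
  split_ifs with hn
  · have h4 : Measurable fun x : (Fin n → ℝ) × ℝ => (pathEnd γ y n x.1 - γ x.2, x.2) := by
      fun_prop
    exact (h4 hG).inter (h3 fun _ => r)
  · have h4 : Measurable fun x : (Fin n → ℝ) × ℝ => (pathEnd γ y n x.1, x.2) := by
      fun_prop
    exact (h4 hG).inter (h3 fun k : Fin n => if (k : ℕ) + 1 = n then b else a)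

/-- The invariant of the walk. At odd length the current vertex carries the edge just used, whose
label is r-separated from all earlier ones; this is the hypothesis of the second half of
`IsBranching`. -/
theorem pathEnd_mem {γ : ℝ → EuclideanSpace ℝ (Fin m)} {M : ℝ → ℝ}
    {G : Set (EuclideanSpace ℝ (Fin m) × ℝ)} {r a b : ℝ} {y : EuclideanSpace ℝ (Fin m)}
    (hy : ∃ t, (y - γ t, t) ∈ G) (n : ℕ) :
    ∀ p ∈ pathSet (pathStep γ M G r a b y) n,
      (Even n → ∃ t, (pathEnd γ y n p - γ t, t) ∈ G) ∧
      (¬ Even n → ∃ t, (pathEnd γ y n p, t) ∈ G ∧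
        ∀ k : Fin n, if (k : ℕ) + 1 = n then p k = t else r ≤ |M (p k) - M t|) := by
  cases n with
  | zero =>
    intro p _
    refine ⟨fun _ => ?_, fun h => (h (by simp)).elim⟩
    simpa [pathEnd] using hy
  | succ n =>
    rintro p ⟨-, hp⟩
    rw [pathEnd_succ]
    unfold pathStep at hp
    constructor
    · intro h
      have hn : ¬ Even n := by rwa [Nat.even_add_one] at h
      rw [if_neg hn] at hp
      refine ⟨p (Fin.last n), ?_⟩
      rw [h.neg_one_pow, one_smul, add_sub_cancel_right]
      exact hp.1
    · intro h
      have hn : Even n := by rwa [Nat.even_add_one, not_not] at h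
      rw [if_pos hn] at hp
      refine ⟨p (Fin.last n), ?_, fun k => ?_⟩
      · rw [(Nat.not_even_iff_odd.1 h).neg_one_pow, neg_one_smul, ← sub_eq_add_neg]
        exact hp.1
      · induction k using Fin.lastCases with
        | last => simp
        | cast k =>
          rw [if_neg (by simp only [Fin.val_castSucc]; omega)]
          exact hp.2 k

theorem pathSet_separated {γ : ℝ → EuclideanSpace ℝ (Fin m)} {M : ℝ → ℝ}
    {G : Set (EuclideanSpace ℝ (Fin m) × ℝ)} {r a b : ℝ} {y : EuclideanSpace ℝ (Fin m)}
    (har : a ≤ r) (n : ℕ) :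
    ∀ p ∈ pathSet (pathStep γ M G r a b y) n,
      (∀ j, ∃ x, (x, p j) ∈ G) ∧ ∀ i j : Fin n, i < j →
        (if ¬ Even (j : ℕ) ∧ (i : ℕ) + 1 = j then b else a) ≤ |M (p i) - M (p j)| := by
  induction n with
  | zero => exact fun p _ => ⟨fun j => j.elim0, fun j => j.elim0⟩
  | succ n ih =>
    rintro p ⟨hp1, hp⟩
    obtain ⟨ih1, ih2⟩ := ih _ hp1
    unfold pathStep at hp
    constructor
    · intro j
      induction j using Fin.lastCases with
      | last => split_ifs at hp with hn; exacts [⟨_, hp.1⟩, ⟨_, hp.1⟩]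
      | cast j => exact ih1 j
    · intro i j hij
      induction i using Fin.lastCases with
      | last => exact absurd hij (not_lt.2 (Fin.le_last j))
      | cast i =>
        induction j using Fin.lastCases with
        | last =>
          by_cases hn : Even n
          · rw [if_pos hn] at hp
            rw [if_neg (by simp [hn])]
            exact har.trans (hp.2 i)
          · rw [if_neg hn] at hp
            have := hp.2 i
            simpa [hn, Fin.init] using this
        | cast j => simpa [Fin.init] using ih2 i j (by simpa using hij)

/-- A branching graph contains many paths of length `d` with separated labels. -/
theorem exists_paths {d : ℕ} {w : ℝ → ℝ≥0∞} (hw : Measurable w)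
    {γ : ℝ → EuclideanSpace ℝ (Fin m)} (hγ : Measurable γ)
    {M : ℝ → ℝ} (hM : Measurable M) {G : Set (EuclideanSpace ℝ (Fin m) × ℝ)}
    (hG : MeasurableSet G) (hGn : G.Nonempty) {κ α β : ℝ}
    (hbr : IsBranching (volume.withDensity w) γ M d κ α β G) :
    ∃ (y : EuclideanSpace ℝ (Fin m)) (Ω : Set (Fin d → ℝ)), MeasurableSet Ω ∧
      ∏ i ∈ Finset.range d, ENNReal.ofReal (if Even i then κ * α else κ * β) ≤
        ∫⁻ p in Ω, ∏ i, w (p i) ∧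
      ∀ p ∈ Ω, (∀ j, ∃ x, (x, p j) ∈ G) ∧
        (∀ i j : Fin d, i < j → (if ¬ Even (j : ℕ) ∧ (i : ℕ) + 1 = j then κ * β else κ * α) ≤
          |M (p i) - M (p j)|) ∧
        (Even d → ∃ t, (pathEnd γ y d p - γ t, t) ∈ G) ∧
        (¬ Even d → ∃ t, (pathEnd γ y d p, t) ∈ G) := by
  classical
  obtain ⟨r, hr, hbr⟩ := hbr
  obtain ⟨p₀, hp₀⟩ := hGn
  set y := p₀.1 + γ p₀.2 with hy
  have hy' : ∃ t, (y - γ t, t) ∈ G := ⟨p₀.2, by simpa [hy] using hp₀⟩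
  have hQ := measurableSet_pathStep hγ hM hG r (κ * α) (κ * β) y
  refine ⟨y, pathSet (pathStep γ M G r (κ * α) (κ * β) y) d, measurableSet_pathSet hQ d,
    prod_le_lintegral_pathSet hQ hw (N := d) (fun n hn p hp => ?_) d le_rfl, fun p hp => ?_⟩
  · obtain ⟨h1, h2⟩ := pathEnd_mem hy' n p hp
    by_cases hne : Even n
    · obtain ⟨t, ht⟩ := h1 hne
      have h3 := (hbr _ ht (Finset.univ.image p) ((Finset.card_image_le).trans
        (by simpa using hn.le))).1
      rw [if_pos hne]
      refine h3.trans (measure_mono ?_)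
      rintro s ⟨hs1, hs2⟩
      simp only [Set.mem_ofPred_eq, pathStep, if_pos hne]
      exact ⟨by simpa using hs1, fun k => hs2 _ (Finset.mem_image_of_mem _ (Finset.mem_univ _))⟩
    · obtain ⟨t, ht, ht'⟩ := h2 hne
      -- The last label is left out of P: it is the label of the incoming edge, from which only
      -- separation κβ is available.
      have h3 := (hbr _ ht ((Finset.univ.filter fun k : Fin n => (k : ℕ) + 1 ≠ n).image p)
        ((Finset.card_image_le).trans ((Finset.card_filter_le _ _).trans
        (by simpa using hn.le)))).2 (by
          intro q hq
          obtain ⟨k, hk, rfl⟩ := Finset.mem_image.1 hq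
          have := ht' k
          rwa [if_neg (Finset.mem_filter.1 hk).2] at this)
      rw [if_neg hne]
      refine h3.trans (measure_mono ?_)
      rintro s ⟨hs1, hs2, hs3⟩
      simp only [Set.mem_ofPred_eq, pathStep, if_neg hne]
      refine ⟨hs1, fun k => ?_⟩
      have hk' := ht' k
      split_ifs with hk
      · rw [if_pos hk] at hk'
        rw [hk']; exact hs2
      · exact hs3 _ (Finset.mem_image_of_mem _ (by simpa using hk))
  · obtain ⟨h1, h2⟩ := pathEnd_mem hy' d p hp
    obtain ⟨h3, h4⟩ := pathSet_separated hr d p hp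
    exact ⟨h3, h4, h1, fun h => (h2 h).imp fun t ht => ht.1⟩

/-! ### Log-concave densities: distance against mass -/

/-- log f is concave and rises by more than 1 from s to u, so its chords to the left of s have slope
at least 1/(u - s). -/
theorem LogConcaveOn.le_exp_mul {J : Set ℝ} {f : ℝ → ℝ} (hf : LogConcaveOn J f)
    (hpos : ∀ t ∈ J, 0 < f t) {v s u : ℝ} (hv : v ∈ J) (hs : s ∈ J) (hu : u ∈ J) (hvs : v < s)
    (hsu : s < u) (h : Real.exp 1 * f s < f u) :
    f v ≤ f s * Real.exp ((v - s) / (u - s)) := by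
  have huv : 0 < u - v := by linarith
  have hθ : (u - s) / (u - v) ∈ Set.Icc (0 : ℝ) 1 :=
    ⟨div_nonneg (by linarith) huv.le, (div_le_one huv).2 (by linarith)⟩
  have h1 := hf.2 v hv u hu _ hθ
  have h2 : (u - s) / (u - v) * v + (1 - (u - s) / (u - v)) * u = s := by field_simp; ring
  rw [h2] at h1
  have hfv := hpos v hv
  have hfs := hpos s hs
  have hfu := hpos u hu
  have h3 := Real.log_le_log (by positivity) h1
  rw [Real.log_mul (by positivity) (by positivity), Real.log_rpow hfv, Real.log_rpow hfu] at h3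
  have h4 := Real.log_lt_log (by positivity) h
  rw [Real.log_mul (by positivity) (by positivity), Real.log_exp] at h4
  have h5 : 1 - (u - s) / (u - v) = (s - v) / (u - v) := by field_simp; ring
  rw [h5] at h3
  have h6 : (u - s) * Real.log (f v) + (s - v) * Real.log (f u) ≤ (u - v) * Real.log (f s) := by
    have := mul_le_mul_of_nonneg_left h3 huv.le
    calc _ = (u - v) * ((u - s) / (u - v) * Real.log (f v) + (s - v) / (u - v) * Real.log (f u)) := by
          field_simp
      _ ≤ _ := this
  have h7 : Real.log (f v) ≤ Real.log (f s) + (v - s) / (u - s) := by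
    rw [← sub_le_iff_le_add', le_div_iff₀ (by linarith)]
    nlinarith
  calc f v = Real.exp (Real.log (f v)) := (Real.exp_log hfv).symm
    _ ≤ Real.exp (Real.log (f s) + (v - s) / (u - s)) := Real.exp_le_exp.2 h7
    _ = _ := by rw [Real.exp_add, Real.exp_log hfs]

theorem lintegral_Iio_exp {s h : ℝ} (hh : 0 < h) {c : ℝ} (hc : 0 ≤ c) :
    ∫⁻ v in Set.Iio s, ENNReal.ofReal (c * Real.exp ((v - s) / h)) = ENNReal.ofReal (c * h) := by
  have h1 : ∀ v, c * Real.exp ((v - s) / h) = c * Real.exp (-s / h) * Real.exp (h⁻¹ * v) := by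
    intro v
    rw [mul_assoc, ← Real.exp_add]
    congr 2; field_simp; ring
  have hint : IntegrableOn (fun v => c * Real.exp ((v - s) / h)) (Set.Iic s) := by
    simp only [h1]
    exact (integrableOn_exp_mul_Iic (inv_pos.2 hh) s).const_mul _
  rw [setLIntegral_congr Iio_ae_eq_Iic, ← ofReal_integral_eq_lintegral_ofReal hint
    (Filter.Eventually.of_forall fun v => by positivity)]
  congr 1
  simp only [h1]
  rw [integral_const_mul, integral_exp_mul_Iic (inv_pos.2 hh)]
  have : Real.exp (-s / h) * Real.exp (h⁻¹ * s) = 1 := by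
    rw [← Real.exp_add]
    have : -s / h + h⁻¹ * s = 0 := by field_simp; ring
    rw [this, Real.exp_zero]
  rw [div_inv_eq_mul, mul_assoc, ← mul_assoc (Real.exp _), this, one_mul]

/-- For a log-concave density, an interval much heavier than its length times the value at the
left endpoint has a light left tail. -/
theorem LogConcaveOn.tail_or_interval_left {J : Set ℝ} (hJ : J.OrdConnected) {f : ℝ → ℝ}
    (hf : LogConcaveOn J f) (hpos : ∀ t ∈ J, 0 < f t) {c : ℝ} (hc : 0 < c) {w : ℝ → ℝ≥0∞}
    (hw : ∀ t ∈ J, w t ≤ ENNReal.ofReal (c * f t)) (hw0 : ∀ t ∉ J, w t = 0) {s t : ℝ}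
    (hs : s ∈ J) (ht : t ∈ J) :
    ∫⁻ v in Set.Iio s, w v ≤ ENNReal.ofReal (c * f s * (t - s)) ∨
      ∫⁻ v in Set.Icc s t, w v ≤ ENNReal.ofReal (3 * c * f s * (t - s)) := by
  have hfs := hpos s hs
  -- Either f exceeds e·f(s) somewhere on [s, t], and then decays exponentially to the left of s at
  -- scale at most t - s, or f ≤ 3f(s) on all of [s, t].
  by_cases h : ∃ u ∈ Set.Icc s t, Real.exp 1 * f s < f u
  · left
    obtain ⟨u, hu, hlt⟩ := h
    have huJ : u ∈ J := hJ.out hs ht hu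
    have hsu : s < u := by
      refine lt_of_le_of_ne hu.1 ?_
      rintro rfl
      have := Real.add_one_le_exp 1
      nlinarith
    calc ∫⁻ v in Set.Iio s, w v
        ≤ ∫⁻ v in Set.Iio s, ENNReal.ofReal (c * f s * Real.exp ((v - s) / (u - s))) := by
          refine setLIntegral_mono (by fun_prop) fun v hv => ?_
          by_cases hvJ : v ∈ J
          · refine (hw v hvJ).trans (ENNReal.ofReal_le_ofReal ?_)
            rw [mul_assoc]
            exact mul_le_mul_of_nonneg_left (hf.le_exp_mul hpos hvJ hs huJ hv hsu hlt) hc.le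
          · rw [hw0 v hvJ]; exact zero_le
      _ = ENNReal.ofReal (c * f s * (u - s)) := lintegral_Iio_exp (by linarith) (by positivity)
      _ ≤ _ := ENNReal.ofReal_le_ofReal (by
          have : u - s ≤ t - s := by linarith [hu.2]
          gcongr)
  · right
    push Not at h
    calc ∫⁻ v in Set.Icc s t, w v ≤ ∫⁻ _ in Set.Icc s t, ENNReal.ofReal (3 * c * f s) := by
          refine setLIntegral_mono measurable_const fun v hv => ?_
          refine (hw v (hJ.out hs ht hv)).trans (ENNReal.ofReal_le_ofReal ?_)
          have h1 := h v hv
          have h2 := Real.exp_one_lt_d9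
          have h3 : f v ≤ 3 * f s := by nlinarith
          nlinarith
      _ = _ := by
          rw [setLIntegral_const, Real.volume_Icc, ← ENNReal.ofReal_mul (by positivity)]

theorem LogConcaveOn.comp_neg {J : Set ℝ} {f : ℝ → ℝ} (hf : LogConcaveOn J f) :
    LogConcaveOn (-J) fun t => f (-t) := by
  refine ⟨fun t ht => hf.1 _ ht, fun t₁ h₁ t₂ h₂ θ hθ => ?_⟩
  have := hf.2 _ h₁ _ h₂ θ hθ
  convert this using 2
  ring

theorem LogConcaveOn.tail_or_interval_right {J : Set ℝ} (hJ : J.OrdConnected) {f : ℝ → ℝ}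
    (hf : LogConcaveOn J f) (hpos : ∀ t ∈ J, 0 < f t) {c : ℝ} (hc : 0 < c) {w : ℝ → ℝ≥0∞}
    (hw : ∀ t ∈ J, w t ≤ ENNReal.ofReal (c * f t)) (hw0 : ∀ t ∉ J, w t = 0) {s t : ℝ}
    (hs : s ∈ J) (ht : t ∈ J) :
    ∫⁻ v in Set.Ioi t, w v ≤ ENNReal.ofReal (c * f t * (t - s)) ∨
      ∫⁻ v in Set.Icc s t, w v ≤ ENNReal.ofReal (3 * c * f t * (t - s)) := by
  have hJ' : (-J).OrdConnected := by
    refine ⟨fun x hx y hy z hz => ?_⟩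
    exact hJ.out (Set.mem_neg.1 hy) (Set.mem_neg.1 hx) ⟨neg_le_neg hz.2, neg_le_neg hz.1⟩
  have h := LogConcaveOn.tail_or_interval_left (J := -J) hJ' hf.comp_neg
    (fun u hu => hpos _ hu) hc (w := fun u => w (-u)) (fun u hu => hw _ hu)
    (fun u hu => hw0 _ hu) (s := -t) (t := -s) (by simpa using ht) (by simpa using hs)
  have hmp := Measure.measurePreserving_neg (volume : Measure ℝ)
  have hemb : MeasurableEmbedding (Neg.neg : ℝ → ℝ) := (MeasurableEquiv.neg ℝ).measurableEmbedding
  have h1 := hmp.setLIntegral_comp_preimage_emb hemb w (Set.Ioi t)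
  have h2 := hmp.setLIntegral_comp_preimage_emb hemb w (Set.Icc s t)
  have e1 : (Neg.neg : ℝ → ℝ) ⁻¹' Set.Ioi t = Set.Iio (-t) := by
    ext x; simp
  have e2 : (Neg.neg : ℝ → ℝ) ⁻¹' Set.Icc s t = Set.Icc (-t) (-s) := by
    ext x; simp only [Set.mem_preimage, Set.mem_Icc]; constructor <;> rintro ⟨h, h'⟩ <;>
      constructor <;> linarith
  rw [e1] at h1
  rw [e2] at h2
  rw [h1, h2] at h
  simpa [neg_add_eq_sub] using h

/-- The distance of two points, weighted by the geometric mean of a density comparable to a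
log-concave function, controls the mass between them up to the mass of the tails. -/
theorem LogConcaveOn.min_mass_le {J : Set ℝ} (hJ : J.OrdConnected) {f l : ℝ → ℝ}
    (hf : LogConcaveOn J f) (hpos : ∀ t ∈ J, 0 < f t) {c₁ c₂ : ℝ} (hc₁ : 0 < c₁) (hc₂ : 0 < c₂)
    (hl : ∀ t ∈ J, c₁ * f t ≤ l t ∧ l t ≤ c₂ * f t) {s t : ℝ}
    (hs : s ∈ J) (ht : t ∈ J) (hst : s < t) {A D : ℝ}
    (hA₁ : ENNReal.ofReal A ≤ ∫⁻ v in Set.Iio s, J.indicator (fun u => ENNReal.ofReal (l u)) v)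
    (hA₂ : ENNReal.ofReal A ≤ ∫⁻ v in Set.Ioi t, J.indicator (fun u => ENNReal.ofReal (l u)) v)
    (hD : ENNReal.ofReal D ≤ ∫⁻ v in Set.Icc s t, J.indicator (fun u => ENNReal.ofReal (l u)) v) :
    c₁ / (3 * c₂) * min A D ≤ Real.sqrt (l s * l t) * (t - s) := by
  set w := J.indicator (fun u => ENNReal.ofReal (l u)) with hw
  have hw1 : ∀ t ∈ J, w t ≤ ENNReal.ofReal (c₂ * f t) := fun t ht => by
    rw [hw, Set.indicator_of_mem ht]; exact ENNReal.ofReal_le_ofReal (hl t ht).2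
  have hw0 : ∀ t ∉ J, w t = 0 := fun t ht => Set.indicator_of_notMem ht _
  have hfs := hpos s hs
  have hft := hpos t ht
  have hts : 0 < t - s := by linarith
  have key : ∀ x, 0 < x → (ENNReal.ofReal A ≤ ENNReal.ofReal (c₂ * x * (t - s)) ∨
      ENNReal.ofReal D ≤ ENNReal.ofReal (3 * c₂ * x * (t - s))) →
      c₁ / (3 * c₂) * min A D ≤ c₁ * x * (t - s) := by
    intro x hx h
    have h1 : min A D ≤ 3 * c₂ * x * (t - s) := by
      rcases h with h | h
      · rw [ENNReal.ofReal_le_ofReal_iff (by positivity)] at h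
        refine (min_le_left _ _).trans (h.trans ?_)
        have : 0 < c₂ * x * (t - s) := by positivity
        linarith
      · rw [ENNReal.ofReal_le_ofReal_iff (by positivity)] at h
        exact (min_le_right _ _).trans h
    calc c₁ / (3 * c₂) * min A D ≤ c₁ / (3 * c₂) * (3 * c₂ * x * (t - s)) := by gcongr
      _ = _ := by field_simp
  have hsq : ∀ x, 0 < x → x ≤ f s → x ≤ f t → c₁ * x ≤ Real.sqrt (l s * l t) := by
    intro x hx h1 h2
    refine Real.le_sqrt_of_sq_le ?_
    rw [sq]
    have h3 : c₁ * x ≤ l s := (mul_le_mul_of_nonneg_left h1 hc₁.le).trans (hl s hs).1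
    have h4 : c₁ * x ≤ l t := (mul_le_mul_of_nonneg_left h2 hc₁.le).trans (hl t ht).1
    have : 0 < c₁ * x := by positivity
    exact mul_le_mul h3 h4 this.le (this.le.trans h3)
  -- Work from the endpoint with the smaller value of f, which is at most the geometric mean of the
  -- two.
  rcases le_total (f s) (f t) with hle | hle
  · refine (key (f s) hfs ?_).trans (mul_le_mul_of_nonneg_right (hsq _ hfs le_rfl hle) hts.le)
    exact (hf.tail_or_interval_left hJ hpos hc₂ hw1 hw0 hs ht).imp hA₁.trans hD.trans
  · refine (key (f t) hft ?_).trans (mul_le_mul_of_nonneg_right (hsq _ hft hle le_rfl) hts.le)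
    exact (hf.tail_or_interval_right hJ hpos hc₂ hw1 hw0 hs ht).imp hA₂.trans hD.trans

/-! ### The mass coordinate -/

section Mass

variable {μ : Measure ℝ} [IsFiniteMeasure μ]

theorem monotone_measureReal_Iio : Monotone fun t => μ.real (Set.Iio t) :=
  fun _ _ h => measureReal_mono (Set.Iio_subset_Iio h)

variable [NullSingletonClass μ]

theorem measure_Icc_eq_ofReal {s t : ℝ} (hst : s ≤ t) :
    μ (Set.Icc s t) = ENNReal.ofReal (μ.real (Set.Iio t) - μ.real (Set.Iio s)) := by
  have h1 : Set.Iio t \ Set.Iio s = Set.Ico s t := by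
    ext x; simp
  rw [← measure_congr Ico_ae_eq_Icc, ← h1, ← measureReal_sdiff (Set.Iio_subset_Iio hst)
    measurableSet_Iio, ofReal_measureReal]

/-- By inner regularity it suffices to bound compact K in the preimage. The extreme points of K lie
in K, and without atoms the mass between them is the difference of their coordinates. -/
theorem measure_preimage_Icc_le (u v : ℝ) :
    μ ((fun t => μ.real (Set.Iio t)) ⁻¹' Set.Icc u v) ≤ ENNReal.ofReal (v - u) := by
  have hm : MeasurableSet ((fun t => μ.real (Set.Iio t)) ⁻¹' Set.Icc u v) :=
    monotone_measureReal_Iio.measurable measurableSet_Icc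
  rw [hm.measure_eq_iSup_isCompact]
  refine iSup₂_le fun K hK => iSup_le fun hKc => ?_
  rcases K.eq_empty_or_nonempty with rfl | hne
  · simp
  have h1 := hKc.sInf_mem hne
  have h2 := hKc.sSup_mem hne
  calc μ K ≤ μ (Set.Icc (sInf K) (sSup K)) :=
        measure_mono (subset_Icc_csInf_csSup hKc.bddBelow hKc.bddAbove)
    _ = _ := measure_Icc_eq_ofReal (csInf_le_csSup hne hKc.bddBelow hKc.bddAbove)
    _ ≤ _ := ENNReal.ofReal_le_ofReal (by linarith [(hK h1).1, (hK h2).2])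

end Mass

/-! ### Counting exponents -/

/-- The lower bound for the separation of the labels of index `i < j` of a path. -/
def sepBound (a b : ℝ) (i j : ℕ) : ℝ := if ¬ Even j ∧ i + 1 = j then b else a

/-- The lower bound for the weighted measure of a set of paths of length `d`. -/
def pathProd (c a b : ℝ) (d : ℕ) : ℝ :=
  ∏ j ∈ Finset.range d, (∏ i ∈ Finset.range j, c * sepBound a b i j) * if Even j then a else b

theorem prod_Ioi_mul_eq_pathProd (c a b : ℝ) (d : ℕ) :
    (∏ i : Fin d, ∏ j ∈ Finset.Ioi i, c * sepBound a b i j) *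
      ∏ i ∈ Finset.range d, (if Even i then a else b) = pathProd c a b d := by
  unfold pathProd
  rw [Finset.prod_mul_distrib]
  congr 1
  rw [Finset.prod_comm' (t' := Finset.univ) (s' := fun j => Finset.Iio j) (by simp),
    Finset.prod_range]
  refine Finset.prod_congr rfl fun j _ => ?_
  refine Finset.prod_bij (fun i _ => (i : ℕ)) ?_ ?_ ?_ ?_
  · intro i hi; simpa using hi
  · intro i _ k _ h; exact Fin.ext h
  · intro i hi
    have := Finset.mem_range.1 hi
    exact ⟨⟨i, by omega⟩, by simpa [Fin.lt_def] using this, rfl⟩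
  · intro i _; rfl

theorem pathProd_succ_of_even (c a b : ℝ) {d : ℕ} (hd : Even d) :
    pathProd c a b (d + 1) = pathProd c a b d * ((c * a) ^ d * a) := by
  unfold pathProd
  rw [Finset.prod_range_succ, if_pos hd]
  congr 2
  simp [sepBound, hd]

theorem pathProd_succ_of_odd (c a b : ℝ) {d : ℕ} (hd : Even d) :
    pathProd c a b (d + 1 + 1) = pathProd c a b (d + 1) * ((c * a) ^ d * (c * b) * b) := by
  have hd' : ¬ Even (d + 1) := by rwa [Nat.even_add_one, not_not]
  unfold pathProd
  rw [Finset.prod_range_succ _ (d + 1), if_neg hd', Finset.prod_range_succ (n := d)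
    (f := fun i => c * sepBound a b i (d + 1))]
  congr 3
  · rw [Finset.prod_congr rfl (g := fun _ => c * a)]
    · simp
    · intro i hi
      have := Finset.mem_range.1 hi
      rw [sepBound, if_neg (by omega)]
  · rw [sepBound, if_pos ⟨hd', rfl⟩]

/-- The exponents of a and c in `pathProd` are both 2k² - k; the factor (ac)^k on the left avoids
subtraction in ℕ. -/
theorem pathProd_even (c a b : ℝ) (k : ℕ) :
    pathProd c a b (2 * k) * (a ^ k * c ^ k) = c ^ (2 * k ^ 2) * a ^ (2 * k ^ 2) * b ^ (2 * k) := by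
  induction k with
  | zero => simp [pathProd]
  | succ k ih =>
    rw [show 2 * (k + 1) = 2 * k + 1 + 1 by ring, pathProd_succ_of_odd c a b (even_two_mul k),
      pathProd_succ_of_even c a b (even_two_mul k)]
    calc _ = pathProd c a b (2 * k) * (a ^ k * c ^ k) *
          ((c * a) ^ (2 * k) * a * ((c * a) ^ (2 * k) * (c * b) * b) * (a * c)) := by ring
      _ = _ := by rw [ih]; ring

theorem pathProd_odd (c a b : ℝ) (k : ℕ) :
    pathProd c a b (2 * k + 1) * (a ^ k * c ^ k) =
      c ^ (2 * k ^ 2 + 2 * k) * a ^ (2 * k ^ 2 + 2 * k + 1) * b ^ (2 * k) := by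
  rw [pathProd_succ_of_even c a b (even_two_mul k)]
  calc _ = pathProd c a b (2 * k) * (a ^ k * c ^ k) * ((c * a) ^ (2 * k) * a) := by ring
    _ = _ := by rw [pathProd_even]; ring

/-- Divide by f^k and take the D-th root: d/D = 1/p_d and (u - k)/D = 1/q_d'. -/
theorem le_of_pow_mul_le {d D k u : ℕ} (hd : 1 ≤ d) (hD : (D : ℝ) = d * (d + 1) / 2)
    (hu : (u : ℝ) - k = ((d : ℝ) ^ 2 - d + 2) / 2) {C K e f : ℝ} (hC : 0 < C) (hK : 0 < K)
    (he : 0 < e) (hf : 0 < f) (h : K ^ D * f ^ k ≤ C * (f ^ u * e ^ d)) :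
    K ≤ C ^ (1 / (D : ℝ)) * e ^ (1 / (((d : ℝ) + 1) / 2)) *
      f ^ (1 / ((d : ℝ) * ((d : ℝ) + 1) / ((d : ℝ) ^ 2 - (d : ℝ) + 2))) := by
  have hd0 : (1 : ℝ) ≤ d := by exact_mod_cast hd
  have hD0 : (0 : ℝ) < D := by rw [hD]; positivity
  have h1 : K ^ (D : ℝ) ≤ C * (e ^ (d : ℝ) * f ^ ((u : ℝ) - k)) := by
    rw [Real.rpow_sub hf, Real.rpow_natCast, Real.rpow_natCast, Real.rpow_natCast,
      Real.rpow_natCast, mul_div_assoc', mul_div_assoc', le_div_iff₀ (by positivity)]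
    calc _ ≤ _ := h
      _ = _ := by ring
  have h2 := Real.rpow_le_rpow (by positivity) h1 (one_div_nonneg.2 hD0.le)
  rw [← Real.rpow_mul hK.le, mul_one_div_cancel hD0.ne', Real.rpow_one,
    Real.mul_rpow hC.le (by positivity), Real.mul_rpow (by positivity) (by positivity),
    ← Real.rpow_mul he.le, ← Real.rpow_mul hf.le, ← mul_assoc] at h2
  have hpos : (0 : ℝ) < (d : ℝ) ^ 2 - d + 2 := by nlinarith
  have e1 : (d : ℝ) * (1 / (D : ℝ)) = 1 / (((d : ℝ) + 1) / 2) := by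
    rw [hD]; field_simp
  have e2 : ((u : ℝ) - k) * (1 / (D : ℝ)) =
      1 / ((d : ℝ) * ((d : ℝ) + 1) / ((d : ℝ) ^ 2 - (d : ℝ) + 2)) := by
    rw [hu, hD]; field_simp
  rwa [e1, e2] at h2

/-- The lower bounds for the measures of `E` and `F` imply the restricted estimate. -/
theorem exists_bound_of_pathProd_le {d : ℕ} (hd : 1 ≤ d) {N c κ Cγ : ℝ} (hN : 0 < N) (hc : 0 < c)
    (hκ : 0 < κ) (hCγ : 0 < Cγ) :
    ∃ C : ℝ, 0 < C ∧ ∀ K e f : ℝ, 0 < K → 0 < e → 0 < f →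
      Cγ * pathProd c (κ * (K / f)) (κ * (K / e)) d ≤ N * (if Even d then f else e) →
      K ≤ C * e ^ (1 / (((d : ℝ) + 1) / 2)) *
        f ^ (1 / ((d : ℝ) * ((d : ℝ) + 1) / ((d : ℝ) ^ 2 - (d : ℝ) + 2))) := by
  -- Parity decides both the exponents in `pathProd` and the set containing the endpoints.
  obtain ⟨k, rfl | rfl⟩ := Nat.even_or_odd' d
  · have hk : 1 ≤ k := by omega
    set P := Cγ * c ^ (2 * k ^ 2) * κ ^ (2 * k ^ 2 + 2 * k) with hP
    set Q := N * c ^ k * κ ^ k with hQ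
    have hP0 : 0 < P := by positivity
    have hQ0 : 0 < Q := by positivity
    refine ⟨(Q / P) ^ (1 / ((2 * k ^ 2 + k : ℕ) : ℝ)), by positivity, fun K e f hK he hf h => ?_⟩
    rw [if_pos (even_two_mul k)] at h
    refine le_of_pow_mul_le hd (D := 2 * k ^ 2 + k) (k := k) (u := 2 * k ^ 2 + 1)
      (by push_cast; ring) (by push_cast; ring) (by positivity) hK he hf ?_
    have h1 := mul_le_mul_of_nonneg_right h
      (by positivity : 0 ≤ (κ * (K / f)) ^ k * c ^ k)
    rw [mul_assoc, pathProd_even] at h1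
    have h2 : P * (K ^ (2 * k ^ 2 + k) * f ^ k) ≤ Q * (f ^ (2 * k ^ 2 + 1) * e ^ (2 * k)) := by
      have h3 := mul_le_mul_of_nonneg_right h1
        (by positivity : 0 ≤ f ^ (2 * k ^ 2) * f ^ k * e ^ (2 * k) / K ^ k)
      calc _ = Cγ * (c ^ (2 * k ^ 2) * (κ * (K / f)) ^ (2 * k ^ 2) * (κ * (K / e)) ^ (2 * k)) *
          (f ^ (2 * k ^ 2) * f ^ k * e ^ (2 * k) / K ^ k) := by
            rw [hP]; simp only [mul_pow, div_pow, pow_add]; field_simp; ring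
        _ ≤ _ := h3
        _ = _ := by rw [hQ]; simp only [mul_pow, div_pow, pow_add]; field_simp
    rw [div_mul_eq_mul_div, le_div_iff₀ hP0]
    linarith
  · set P := Cγ * c ^ (2 * k ^ 2 + 2 * k) * κ ^ (2 * k ^ 2 + 2 * k + 1 + 2 * k) with hP
    set Q := N * c ^ k * κ ^ k with hQ
    have hP0 : 0 < P := by positivity
    have hQ0 : 0 < Q := by positivity
    refine ⟨(Q / P) ^ (1 / ((2 * k ^ 2 + 3 * k + 1 : ℕ) : ℝ)), by positivity,
      fun K e f hK he hf h => ?_⟩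
    rw [if_neg (by rw [Nat.even_add_one, not_not]; exact even_two_mul k)] at h
    refine le_of_pow_mul_le hd (D := 2 * k ^ 2 + 3 * k + 1) (k := k) (u := 2 * k ^ 2 + 2 * k + 1)
      (by push_cast; ring) (by push_cast; ring) (by positivity) hK he hf ?_
    have h1 := mul_le_mul_of_nonneg_right h
      (by positivity : 0 ≤ (κ * (K / f)) ^ k * c ^ k)
    rw [mul_assoc, pathProd_odd] at h1
    have h2 : P * (K ^ (2 * k ^ 2 + 3 * k + 1) * f ^ k) ≤
        Q * (f ^ (2 * k ^ 2 + 2 * k + 1) * e ^ (2 * k + 1)) := by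
      have h3 := mul_le_mul_of_nonneg_right h1
        (by positivity : 0 ≤ f ^ (2 * k ^ 2 + 2 * k + 1) * f ^ k * e ^ (2 * k) / K ^ k)
      calc _ = Cγ * (c ^ (2 * k ^ 2 + 2 * k) * (κ * (K / f)) ^ (2 * k ^ 2 + 2 * k + 1) *
          (κ * (K / e)) ^ (2 * k)) *
          (f ^ (2 * k ^ 2 + 2 * k + 1) * f ^ k * e ^ (2 * k) / K ^ k) := by
            rw [hP]; simp only [mul_pow, div_pow, pow_add]; field_simp; ring
        _ ≤ _ := h3
        _ = _ := by rw [hQ]; simp only [mul_pow, div_pow, pow_add]; field_simp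
    rw [div_mul_eq_mul_div, le_div_iff₀ hP0]
    linarith

/-! ### The estimate on an interval of finite mass -/

theorem prod_pairs_eq_prod_pow {n : ℕ} (x : Fin (n + 1) → ℝ) :
    ∏ i, ∏ j ∈ Finset.Ioi i, x i * x j = ∏ j, x j ^ n := by
  simp only [Finset.prod_mul_distrib]
  rw [Finset.prod_comm' (s := Finset.univ) (t := fun i => Finset.Ioi i) (t' := Finset.univ)
    (s' := fun j => Finset.Iio j) (f := fun _ j => x j) (by simp), ← Finset.prod_mul_distrib]
  refine Finset.prod_congr rfl fun i _ => ?_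
  rw [Finset.prod_const, Finset.prod_const, ← pow_add, Fin.card_Ioi, Fin.card_Iio]
  congr 1
  omega

/-- Lower bound for the Jacobian at separated points. -/
theorem le_abs_jacobian_of_separated {n : ℕ} {J : Set ℝ} {l : ℝ → ℝ} (hl : ∀ t ∈ J, 0 < l t)
    {Cγ a b c : ℝ} (hCγ : 0 < Cγ) (ha : 0 < a) (hb : 0 < b) (hc : 0 < c)
    {γ : ℝ → EuclideanSpace ℝ (Fin (n + 1))} {t : EuclideanSpace ℝ (Fin (n + 1))}
    (ht : ∀ j, t j ∈ J)
    (hJac : Cγ * (∏ j, l (t j) * Real.sqrt (l (t j)) ^ n) *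
      (∏ i, ∏ j ∈ Finset.Ioi i, |t j - t i|) ≤ |jacobian γ t|)
    (hsep : ∀ i j : Fin (n + 1), i < j →
      c * sepBound a b i j ≤ Real.sqrt (l (t i) * l (t j)) * |t j - t i|) :
    Cγ * (∏ i : Fin (n + 1), ∏ j ∈ Finset.Ioi i, c * sepBound a b i j) * ∏ j, l (t j) ≤
      |jacobian γ t| := by
  have hsb : ∀ i j : ℕ, 0 < sepBound a b i j := fun i j => by
    unfold sepBound; split_ifs <;> assumption
  refine le_trans ?_ hJac
  have h1 : (∏ i : Fin (n + 1), ∏ j ∈ Finset.Ioi i, c * sepBound a b i j) ≤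
      ∏ i, ∏ j ∈ Finset.Ioi i, (Real.sqrt (l (t i)) * Real.sqrt (l (t j))) * |t j - t i| := by
    refine Finset.prod_le_prod (fun i _ => Finset.prod_nonneg fun j _ =>
      (mul_pos hc (hsb i j)).le) fun i _ => Finset.prod_le_prod (fun j _ =>
      (mul_pos hc (hsb i j)).le) fun j hj => ?_
    rw [← Real.sqrt_mul (hl _ (ht i)).le]
    exact hsep i j (Finset.mem_Ioi.1 hj)
  have h2 : ∏ i, ∏ j ∈ Finset.Ioi i, (Real.sqrt (l (t i)) * Real.sqrt (l (t j))) * |t j - t i| =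
      (∏ j, Real.sqrt (l (t j)) ^ n) * ∏ i, ∏ j ∈ Finset.Ioi i, |t j - t i| := by
    rw [← prod_pairs_eq_prod_pow fun j => Real.sqrt (l (t j))]
    simp only [Finset.prod_mul_distrib]
  rw [h2] at h1
  have h3 : 0 ≤ ∏ j, l (t j) := Finset.prod_nonneg fun j _ => (hl _ (ht j)).le
  calc _ ≤ Cγ * ((∏ j, Real.sqrt (l (t j)) ^ n) * ∏ i, ∏ j ∈ Finset.Ioi i, |t j - t i|) *
        ∏ j, l (t j) := by gcongr
    _ = _ := by rw [Finset.prod_mul_distrib]; ring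

/-- Both labels have mass at least A on either side, so with m ≤ A the minimum in
`LogConcaveOn.min_mass_le` is m. -/
theorem sep_le_of_mass {J : Set ℝ} (hJ : J.OrdConnected) {f l : ℝ → ℝ}
    (hf : LogConcaveOn J f) (hpos : ∀ t ∈ J, 0 < f t) {c₁ c₂ : ℝ} (hc₁ : 0 < c₁) (hc₂ : 0 < c₂)
    (hl : ∀ t ∈ J, c₁ * f t ≤ l t ∧ l t ≤ c₂ * f t) {μ : Measure ℝ} [IsFiniteMeasure μ]
    (hμ : μ = volume.withDensity (J.indicator fun u => ENNReal.ofReal (l u))) {A : ℝ} {s t : ℝ}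
    (hs : s ∈ J) (ht : t ∈ J) (hst : s ≠ t)
    (hs₁ : μ.real (Set.Iio s) ∈ Set.Icc A (μ.real Set.univ - A))
    (ht₁ : μ.real (Set.Iio t) ∈ Set.Icc A (μ.real Set.univ - A)) {m : ℝ} (hmA : m ≤ A)
    (hm : m ≤ |μ.real (Set.Iio s) - μ.real (Set.Iio t)|) :
    c₁ / (3 * c₂) * m ≤ Real.sqrt (l s * l t) * |t - s| := by
  have : NullSingletonClass μ := by rw [hμ]; infer_instance
  wlog hlt : s < t generalizing s t
  · have := this ht hs hst.symm ht₁ hs₁ (by rwa [abs_sub_comm])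
      (lt_of_le_of_ne (not_lt.1 hlt) hst.symm)
    rwa [mul_comm (l t), abs_sub_comm] at this
  rw [abs_of_pos (sub_pos.2 hlt)]
  rw [abs_sub_comm, abs_of_nonneg (sub_nonneg.2 (monotone_measureReal_Iio hlt.le))] at hm
  have h1 := hf.min_mass_le hJ hpos hc₁ hc₂ hl hs ht hlt (A := A) (D := m) (by
      rw [← withDensity_apply _ measurableSet_Iio, ← hμ,
        ENNReal.ofReal_le_iff_le_toReal (measure_ne_top _ _)]
      exact hs₁.1) (by
      rw [← withDensity_apply _ measurableSet_Ioi, ← hμ, measure_congr Ioi_ae_eq_Ici,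
        ENNReal.ofReal_le_iff_le_toReal (measure_ne_top _ _)]
      have h2 := measureReal_compl (μ := μ) (s := Set.Iio t) measurableSet_Iio
      rw [Set.compl_Iio] at h2
      have h3 := ht₁.2
      change A ≤ μ.real (Set.Ici t)
      linarith) (by
      rw [← withDensity_apply _ measurableSet_Icc, ← hμ, measure_Icc_eq_ofReal hlt.le]
      exact ENNReal.ofReal_le_ofReal hm)
  rwa [min_eq_right hmA] at h1

/-- Removing the labels close to the ends of the interval costs few edges. -/
theorem prod_measure_trim_le {X : Type*} [AddCommGroup X] [MeasurableSpace X] [MeasurableAdd₂ X]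
    [MeasurableSub₂ X] {ν : Measure X} [SFinite ν] [ν.IsAddRightInvariant] {μ : Measure ℝ}
    [IsFiniteMeasure μ] [NullSingletonClass μ] {γ : ℝ → X} (hγ : Measurable γ) {G : Set (X × ℝ)}
    (hG : MeasurableSet G) {E F : Set X} (hE : MeasurableSet E) (hF : MeasurableSet F)
    (hGE : ∀ p ∈ G, p.1 ∈ E) (hGF : ∀ p ∈ G, p.1 + γ p.2 ∈ F) {A : ℝ} (hA : 0 ≤ A) :
    (ν.prod μ) (G \ {p | μ.real (Set.Iio p.2) ∈ Set.Icc A (μ.real Set.univ - A)}) ≤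
      ENNReal.ofReal (2 * A) * min (ν E) (ν F) := by
  have hMm : Measurable fun t => μ.real (Set.Iio t) := monotone_measureReal_Iio.measurable
  set B : Set ℝ := {t | μ.real (Set.Iio t) ∉ Set.Icc A (μ.real Set.univ - A)} with hB
  have hBμ : μ B ≤ ENNReal.ofReal (2 * A) := by
    have hsub : B ⊆ (fun t => μ.real (Set.Iio t)) ⁻¹' Set.Icc 0 A ∪
        (fun t => μ.real (Set.Iio t)) ⁻¹' Set.Icc (μ.real Set.univ - A) (μ.real Set.univ) := by
      intro t ht
      rw [hB, Set.mem_ofPred_eq, Set.mem_Icc, not_and_or, not_le, not_le] at ht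
      rcases ht with ht | ht
      · exact Or.inl ⟨measureReal_nonneg, ht.le⟩
      · exact Or.inr ⟨ht.le, measureReal_mono (Set.subset_univ _)⟩
    calc μ B ≤ _ := measure_mono hsub
      _ ≤ _ := measure_union_le _ _
      _ ≤ ENNReal.ofReal (A - 0) + ENNReal.ofReal (μ.real Set.univ - (μ.real Set.univ - A)) :=
        add_le_add (measure_preimage_Icc_le _ _) (measure_preimage_Icc_le _ _)
      _ = _ := by rw [← ENNReal.ofReal_add (by linarith) (by linarith)]; congr 1; ring
  set H := G \ {p : X × ℝ | μ.real (Set.Iio p.2) ∈ Set.Icc A (μ.real Set.univ - A)} with hH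
  have hHm : MeasurableSet H :=
    hG.diff ((hMm.comp measurable_snd) measurableSet_Icc)
  have h1 : (ν.prod μ) H ≤ ENNReal.ofReal (2 * A) * ν E := by
    rw [← lintegral_degL hHm, ← setLIntegral_const, ← lintegral_indicator hE]
    refine lintegral_mono fun x => ?_
    by_cases hx : x ∈ E
    · rw [Set.indicator_of_mem hx]
      exact (measure_mono fun t ht => ht.2).trans hBμ
    · rw [Set.indicator_of_notMem hx]
      refine (measure_mono_null (t := ∅) (fun t ht => hx (hGE _ ht.1)) measure_empty).le
  have h2 : (ν.prod μ) H ≤ ENNReal.ofReal (2 * A) * ν F := by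
    rw [← lintegral_degR hγ hHm, ← setLIntegral_const, ← lintegral_indicator hF]
    refine lintegral_mono fun y => ?_
    by_cases hy : y ∈ F
    · rw [Set.indicator_of_mem hy]
      exact (measure_mono fun t ht => ht.2).trans hBμ
    · rw [Set.indicator_of_notMem hy]
      refine (measure_mono_null (t := ∅) (fun t ht => hy ?_) measure_empty).le
      have := hGF _ ht.1
      simpa using this
  rcases min_choice (ν E) (ν F) with h | h <;> rw [h] <;> assumption

/-- Passage from the measure of a set of paths to the measure of the set of their endpoints. -/
theorem ofReal_mul_lintegral_le {n : ℕ} {J : Set ℝ} (hJ : J.OrdConnected) (hJo : IsOpen J)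
    {γ v : ℝ → EuclideanSpace ℝ (Fin (n + 1))} (hg : ∀ t ∈ J, HasDerivAt γ (v t) t)
    (hv : ContinuousOn v J)
    (hJne : ∀ t : EuclideanSpace ℝ (Fin (n + 1)), (∀ j, t j ∈ J) → Function.Injective t →
      jacobian γ t ≠ 0) {l : ℝ → ℝ} (hlm : Measurable l) (hl : ∀ t ∈ J, 0 < l t)
    {Ω : Set (Fin (n + 1) → ℝ)} (hΩ : MeasurableSet Ω) (hΩJ : ∀ p ∈ Ω, ∀ j, p j ∈ J)
    (hΩi : ∀ p ∈ Ω, Function.Injective p) {S : ℝ}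
    (hS : ∀ p ∈ Ω, S * ∏ j, l (p j) ≤ |jacobian γ (WithLp.toLp 2 p)|)
    {T : Set (EuclideanSpace ℝ (Fin (n + 1)))} (y : EuclideanSpace ℝ (Fin (n + 1)))
    (hT : ∀ p ∈ Ω, pathEnd γ y (n + 1) p ∈ T) :
    ENNReal.ofReal S * ∫⁻ p in Ω, ∏ i, (J.indicator fun u => ENNReal.ofReal (l u)) (p i) ≤
      ((n + 1).factorial : ℝ≥0∞) * volume T := by
  have hmp := PiLp.volume_preserving_ofLp (Fin (n + 1))
  set w : ℝ → ℝ≥0∞ := J.indicator fun u => ENNReal.ofReal (l u) with hw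
  have hwm : Measurable w := (hlm.ennreal_ofReal).indicator hJo.measurableSet
  have hpm : Measurable fun p : Fin (n + 1) → ℝ => ∏ i, w (p i) :=
    Finset.measurable_fun_prod _ fun i _ => hwm.comp (measurable_pi_apply i)
  have hΩ' : MeasurableSet ((WithLp.ofLp : EuclideanSpace ℝ (Fin (n + 1)) → _) ⁻¹' Ω) :=
    hmp.measurable hΩ
  have h1 := lintegral_jacobian_le hJ hJo hg hv hJne hΩ' (fun t ht => hΩJ _ ht)
    (fun t ht => hΩi _ ht) y (T := T) (fun t ht => hT _ ht)
  have hpm' : Measurable fun t : EuclideanSpace ℝ (Fin (n + 1)) => ∏ i, w (t i) :=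
    hpm.comp hmp.measurable
  refine le_trans ?_ h1
  rw [← hmp.setLIntegral_comp_preimage hΩ hpm]
  refine (lintegral_const_mul _ hpm').ge.trans ?_
  refine setLIntegral_mono' hΩ' fun t ht => ?_
  have h2 := hS _ ht
  have h3 : ∏ i, w (t i) = ENNReal.ofReal (∏ i, l (t i)) := by
    rw [ENNReal.ofReal_prod_of_nonneg fun i _ => (hl _ (hΩJ _ ht i)).le]
    exact Finset.prod_congr rfl fun i _ => Set.indicator_of_mem (hΩJ _ ht i) _
  rw [h3, ← ENNReal.ofReal_mul' (Finset.prod_nonneg fun i _ => (hl _ (hΩJ _ ht i)).le)]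
  exact ENNReal.ofReal_le_ofReal h2

/-- The incidence graph of `E` and `F` with labels in `J`. -/
def incidence {m : ℕ} (γ : ℝ → EuclideanSpace ℝ (Fin m)) (J : Set ℝ)
    (E F : Set (EuclideanSpace ℝ (Fin m))) : Set (EuclideanSpace ℝ (Fin m) × ℝ) :=
  {p | p.1 ∈ E ∧ p.1 + γ p.2 ∈ F ∧ p.2 ∈ J}

theorem measurableSet_incidence {m : ℕ} {γ : ℝ → EuclideanSpace ℝ (Fin m)} (hγ : Measurable γ)
    {J : Set ℝ} (hJ : MeasurableSet J) {E F : Set (EuclideanSpace ℝ (Fin m))}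
    (hE : MeasurableSet E) (hF : MeasurableSet F) : MeasurableSet (incidence γ J E F) := by
  have hadd : Measurable fun p : EuclideanSpace ℝ (Fin m) × ℝ => p.1 + γ p.2 := by fun_prop
  exact (measurable_fst hE).inter ((hadd hF).inter (measurable_snd hJ))

/-- The refinement argument itself. Positivity of f and finiteness of the mass are assumed on J, but
the constant does not depend on J or on the mass, which permits exhaustion later. -/
theorem exists_incidence_bound (n : ℕ) {Cγ c₁ c₂ : ℝ} (hCγ : 0 < Cγ) (hc₁ : 0 < c₁)
    (hc₂ : 0 < c₂) :
    ∃ C : ℝ, 0 < C ∧ ∀ (J : Set ℝ) (γ v : ℝ → EuclideanSpace ℝ (Fin (n + 1))) (f l : ℝ → ℝ),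
      J.OrdConnected → IsOpen J → Measurable γ → (∀ t ∈ J, HasDerivAt γ (v t) t) →
      ContinuousOn v J → Measurable l →
      ∫⁻ t, J.indicator (fun u => ENNReal.ofReal (l u)) t ≠ ∞ → LogConcaveOn J f →
      (∀ t ∈ J, 0 < f t) → (∀ t ∈ J, c₁ * f t ≤ l t ∧ l t ≤ c₂ * f t) →
      (∀ t : EuclideanSpace ℝ (Fin (n + 1)), (∀ j, t j ∈ J) →
        Cγ * (∏ j, l (t j) * Real.sqrt (l (t j)) ^ n) *
          (∏ i, ∏ j ∈ Finset.Ioi i, |t j - t i|) ≤ |jacobian γ t|) →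
      ∀ E F : Set (EuclideanSpace ℝ (Fin (n + 1))), MeasurableSet E → MeasurableSet F →
        volume E < ∞ → volume F < ∞ →
        (volume.prod (volume.withDensity (J.indicator fun u => ENNReal.ofReal (l u))))
          (incidence γ J E F) ≤ ENNReal.ofReal C *
            volume E ^ (1 / ((((n + 1 : ℕ) : ℝ) + 1) / 2)) *
            volume F ^ (1 / (((n + 1 : ℕ) : ℝ) * (((n + 1 : ℕ) : ℝ) + 1) /
              (((n + 1 : ℕ) : ℝ) ^ 2 - ((n + 1 : ℕ) : ℝ) + 2))) := by
  set d := n + 1 with hdn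
  have hd : 1 ≤ d := by omega
  have hd' : (1 : ℝ) ≤ d := by exact_mod_cast hd
  set κ : ℝ := 1 / (6144 * d ^ 2) with hκ
  have hκ0 : 0 < κ := by positivity
  have hκ8 : κ ≤ 1 / 8 := by
    rw [hκ]
    apply one_div_le_one_div_of_le (by norm_num)
    nlinarith
  set c : ℝ := c₁ / (3 * c₂) with hc
  have hc0 : 0 < c := by positivity
  obtain ⟨C, hC, hbound⟩ := exists_bound_of_pathProd_le hd (N := (d.factorial : ℝ)) (c := c)
    (κ := κ) (Cγ := Cγ) (by exact_mod_cast Nat.factorial_pos d) hc0 hκ0 hCγ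
  refine ⟨C, hC, fun J γ v f l hJ hJo hγ hg hv hlm hfin hf hpos hl hJac E F hE hF hEf hFf => ?_⟩
  set w : ℝ → ℝ≥0∞ := J.indicator fun u => ENNReal.ofReal (l u) with hw
  have hwm : Measurable w := (hlm.ennreal_ofReal).indicator hJo.measurableSet
  set μ : Measure ℝ := volume.withDensity w with hμ
  have hμf : IsFiniteMeasure μ := isFiniteMeasure_withDensity hfin
  have hl0 : ∀ t ∈ J, 0 < l t := fun t ht => (mul_pos hc₁ (hpos t ht)).trans_le (hl t ht).1
  set G₀ := incidence γ J E F with hG₀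
  have hG₀m : MeasurableSet G₀ := measurableSet_incidence hγ hJo.measurableSet hE hF
  have hGE : ∀ p ∈ G₀, p.1 ∈ E := fun p hp => hp.1
  have hGF : ∀ p ∈ G₀, p.1 + γ p.2 ∈ F := fun p hp => hp.2.1
  have hKE : (volume.prod μ) G₀ ≤ μ Set.univ * volume E := by
    rw [← lintegral_degL hG₀m, ← setLIntegral_const, ← lintegral_indicator hE]
    refine lintegral_mono fun x => ?_
    by_cases hx : x ∈ E
    · rw [Set.indicator_of_mem hx]
      exact measure_mono (Set.subset_univ _)
    · rw [Set.indicator_of_notMem hx]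
      exact (measure_mono_null (t := ∅) (fun t ht => hx (hGE (x, t) ht)) measure_empty).le
  have hKF : (volume.prod μ) G₀ ≤ μ Set.univ * volume F := by
    rw [← lintegral_degR hγ hG₀m, ← setLIntegral_const, ← lintegral_indicator hF]
    refine lintegral_mono fun y => ?_
    by_cases hy : y ∈ F
    · rw [Set.indicator_of_mem hy]
      exact measure_mono (Set.subset_univ _)
    · rw [Set.indicator_of_notMem hy]
      refine (measure_mono_null (t := ∅) (fun t ht => hy ?_) measure_empty).le
      have := hGF _ ht
      simpa using this
  by_cases hK0 : (volume.prod μ) G₀ = 0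
  · rw [hK0]; exact zero_le
  have hKtop : (volume.prod μ) G₀ ≠ ∞ :=
    (hKE.trans_lt (ENNReal.mul_lt_top (measure_lt_top _ _) hEf)).ne
  set K : ℝ := ((volume.prod μ) G₀).toReal with hKdef
  have hK : 0 < K := ENNReal.toReal_pos hK0 hKtop
  have hKof : ENNReal.ofReal K = (volume.prod μ) G₀ := ENNReal.ofReal_toReal hKtop
  have hE0 : volume E ≠ 0 := fun h => hK0 (by simpa [h] using hKE)
  have hF0 : volume F ≠ 0 := fun h => hK0 (by simpa [h] using hKF)
  set e : ℝ := (volume E).toReal with he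
  set e' : ℝ := (volume F).toReal with he'
  have he0 : 0 < e := ENNReal.toReal_pos hE0 hEf.ne
  have he0' : 0 < e' := ENNReal.toReal_pos hF0 hFf.ne
  have heof : ENNReal.ofReal e = volume E := ENNReal.ofReal_toReal hEf.ne
  have heof' : ENNReal.ofReal e' = volume F := ENNReal.ofReal_toReal hFf.ne
  suffices hmain : Cγ * pathProd c (κ * (K / e')) (κ * (K / e)) d ≤
      d.factorial * (if Even d then e' else e) by
    have h1 := hbound K e e' hK he0 he0' hmain
    rw [← hKof, ← heof, ← heof', ENNReal.ofReal_rpow_of_pos he0, ENNReal.ofReal_rpow_of_pos he0',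
      ← ENNReal.ofReal_mul hC.le, ← ENNReal.ofReal_mul (by positivity)]
    exact ENNReal.ofReal_le_ofReal h1
  set α : ℝ := K / e' with hα
  set β : ℝ := K / e with hβ
  have hα0 : 0 < α := by positivity
  have hβ0 : 0 < β := by positivity
  have hαF : ENNReal.ofReal α * volume F = ENNReal.ofReal K := by
    rw [← heof', ← ENNReal.ofReal_mul hα0.le, hα, div_mul_cancel₀ _ he0'.ne']
  have hβE : ENNReal.ofReal β * volume E = ENNReal.ofReal K := by
    rw [← heof, ← ENNReal.ofReal_mul hβ0.le, hβ, div_mul_cancel₀ _ he0.ne']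
  -- Trimming both ends at mass A costs at most 2A min(|E|, |F|) = K/4, while A still dominates the
  -- separations κα and κβ.
  set A : ℝ := max α β / 8 with hA
  have hA0 : 0 < A := by positivity
  set S : Set (EuclideanSpace ℝ (Fin d) × ℝ) :=
    {p | μ.real (Set.Iio p.2) ∈ Set.Icc A (μ.real Set.univ - A)} with hS
  have hMm : Measurable fun t => μ.real (Set.Iio t) := monotone_measureReal_Iio.measurable
  have hSm : MeasurableSet S := (hMm.comp measurable_snd) measurableSet_Icc
  have hlost : (volume.prod μ) (G₀ \ S) ≤ ENNReal.ofReal (1 / 4 * K) := by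
    refine (prod_measure_trim_le hγ hG₀m hE hF hGE hGF hA0.le).trans ?_
    rcases max_choice α β with h | h
    · calc _ ≤ ENNReal.ofReal (2 * A) * volume F := by gcongr; exact min_le_right _ _
        _ = _ := by
          rw [hA, h, show 2 * (α / 8) = 1 / 4 * α by ring, ENNReal.ofReal_mul (by norm_num),
            mul_assoc, hαF, ← ENNReal.ofReal_mul (by norm_num)]
    · calc _ ≤ ENNReal.ofReal (2 * A) * volume E := by gcongr; exact min_le_left _ _
        _ = _ := by
          rw [hA, h, show 2 * (β / 8) = 1 / 4 * β by ring, ENNReal.ofReal_mul (by norm_num),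
            mul_assoc, hβE, ← ENNReal.ofReal_mul (by norm_num)]
  have hkept : ENNReal.ofReal (3 / 4 * K) ≤ (volume.prod μ) (G₀ ∩ S) := by
    have h1 := measure_inter_add_sdiff (μ := volume.prod μ) G₀ hSm
    have h2 : ENNReal.ofReal (3 / 4 * K) + ENNReal.ofReal (1 / 4 * K) ≤
        (volume.prod μ) (G₀ ∩ S) + ENNReal.ofReal (1 / 4 * K) := by
      rw [← ENNReal.ofReal_add (by positivity) (by positivity),
        show 3 / 4 * K + 1 / 4 * K = K by ring, hKof, ← h1]
      gcongr
    exact (ENNReal.add_le_add_iff_right ENNReal.ofReal_ne_top).1 h2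
  obtain ⟨G', hG'G, hG'm, hG'n, hbr⟩ := exists_isBranching (μ := μ)
    (M := fun t => μ.real (Set.Iio t)) measure_preimage_Icc_le hMm hγ (hG₀m.inter hSm) hE hF
    (fun p hp => hGE p hp.1) (fun p hp => hGF p hp.1) hd hα0 hβ0 hK hαF hβE hkept
    ((measure_mono Set.inter_subset_left).trans hKof.ge)
  obtain ⟨y, Ω, hΩ, hΩμ, hΩp⟩ := exists_paths hwm hγ hMm hG'm hG'n hbr
  have hκα : κ * α ≤ A := by
    have : α ≤ max α β := le_max_left _ _
    rw [hA]; nlinarith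
  have hκβ : κ * β ≤ A := by
    have : β ≤ max α β := le_max_right _ _
    rw [hA]; nlinarith
  have hsb : ∀ i j : ℕ, 0 < sepBound (κ * α) (κ * β) i j := fun i j => by
    unfold sepBound; split_ifs <;> positivity
  have hsbA : ∀ i j : ℕ, sepBound (κ * α) (κ * β) i j ≤ A := fun i j => by
    unfold sepBound; split_ifs <;> assumption
  have hΩG : ∀ p ∈ Ω, ∀ j, p j ∈ J ∧ μ.real (Set.Iio (p j)) ∈ Set.Icc A (μ.real Set.univ - A) := by
    intro p hp j
    obtain ⟨x, hx⟩ := (hΩp p hp).1 j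
    exact ⟨(hG'G hx).1.2.2, (hG'G hx).2⟩
  have hΩs : ∀ p ∈ Ω, ∀ i j : Fin d, i < j → sepBound (κ * α) (κ * β) i j ≤
      |μ.real (Set.Iio (p i)) - μ.real (Set.Iio (p j))| := fun p hp => (hΩp p hp).2.1
  have hΩne : ∀ p ∈ Ω, ∀ i j : Fin d, i < j → p i ≠ p j := by
    intro p hp i j hij h
    have := hΩs p hp i j hij
    rw [h, sub_self, abs_zero] at this
    exact absurd (hsb i j) (not_lt.2 this)
  have hend := ofReal_mul_lintegral_le hJ hJo hg hv (fun t ht hinj => by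
      rw [← abs_pos]
      refine lt_of_lt_of_le ?_ (hJac t ht)
      refine mul_pos (mul_pos hCγ (Finset.prod_pos fun j _ => ?_))
        (Finset.prod_pos fun i _ => Finset.prod_pos fun j hj => ?_)
      · have := hl0 _ (ht j)
        positivity
      · rw [abs_pos, sub_ne_zero]
        exact fun h => (Finset.mem_Ioi.1 hj).ne' (hinj h)) hlm hl0 hΩ
    (fun p hp j => (hΩG p hp j).1) (fun p hp i j hij => by
      by_contra hne
      rcases lt_or_gt_of_ne hne with h | h
      · exact hΩne p hp _ _ h hij
      · exact hΩne p hp _ _ h hij.symm)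
    (S := Cγ * ∏ i : Fin d, ∏ j ∈ Finset.Ioi i, c * sepBound (κ * α) (κ * β) i j)
    (fun p hp => le_abs_jacobian_of_separated (t := WithLp.toLp 2 p) hl0 hCγ (by positivity)
      (by positivity) hc0 (fun j => (hΩG p hp j).1) (hJac _ fun j => (hΩG p hp j).1)
      fun i j hij => sep_le_of_mass hJ hf hpos hc₁ hc₂ hl hμ (hΩG p hp i).1 (hΩG p hp j).1
        (hΩne p hp i j hij) (hΩG p hp i).2 (hΩG p hp j).2 (hsbA i j) (hΩs p hp i j hij))
    -- The walk starts in F, so it is back in F after an even number of steps.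
    (T := if Even d then F else E) y (fun p hp => by
      obtain ⟨-, -, h1, h2⟩ := hΩp p hp
      split_ifs with h
      · obtain ⟨t, ht⟩ := h1 h
        have := hGF _ (hG'G ht).1
        simpa using this
      · obtain ⟨t, ht⟩ := h2 h
        exact hGE _ (hG'G ht).1)
  have hT : volume (if Even d then F else E) = ENNReal.ofReal (if Even d then e' else e) := by
    split_ifs
    exacts [heof'.symm, heof.symm]
  have hS0 : 0 ≤ Cγ * ∏ i : Fin d, ∏ j ∈ Finset.Ioi i, c * sepBound (κ * α) (κ * β) i j :=
    mul_nonneg hCγ.le (Finset.prod_nonneg fun i _ => Finset.prod_nonneg fun j _ =>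
      (mul_pos hc0 (hsb i j)).le)
  have hfinal := (mul_le_mul_right hΩμ _).trans hend
  rw [hT, ← ENNReal.ofReal_prod_of_nonneg (fun i _ => by split_ifs <;> positivity),
    ← ENNReal.ofReal_mul hS0, mul_assoc, prod_Ioi_mul_eq_pathProd, ← ENNReal.ofReal_natCast,
    ← ENNReal.ofReal_mul (by positivity), ENNReal.ofReal_le_ofReal_iff (by
      split_ifs <;> positivity)] at hfinal
  exact hfinal

/-! ### Regularity, vanishing torsion and exhaustion -/

theorem measurable_indicator_of_continuousOn {Y : Type*} [TopologicalSpace Y] [MeasurableSpace Y]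
    [BorelSpace Y] [Zero Y] {I : Set ℝ} (hI : IsOpen I) {g : ℝ → Y} (hg : ContinuousOn g I) :
    Measurable (I.indicator g) := by
  classical
  rw [← Set.piecewise_eq_indicator]
  exact hg.measurable_piecewise continuousOn_const hI.measurableSet

theorem continuousOn_iteratedDeriv {d : ℕ} {I : Set ℝ} (hI : IsOpen I)
    {γ : ℝ → EuclideanSpace ℝ (Fin d)} (hγ : ContDiffOn ℝ (d : WithTop ℕ∞) γ I) {k : ℕ}
    (hk : k ≤ d) : ContinuousOn (iteratedDeriv k γ) I := by
  have h1 := hγ.continuousOn_iteratedDerivWithin (m := k) (by exact_mod_cast hk) hI.uniqueDiffOn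
  exact h1.congr fun t ht => (iteratedDerivWithin_of_isOpen hI ht).symm

theorem continuousOn_affineDensity {d : ℕ} {I : Set ℝ} (hI : IsOpen I)
    {γ : ℝ → EuclideanSpace ℝ (Fin d)} (hγ : ContDiffOn ℝ (d : WithTop ℕ∞) γ I) :
    ContinuousOn (affineDensity γ) I := by
  have h1 : ContinuousOn (torsion γ) I := by
    rw [continuousOn_iff_continuous_domRestrict]
    refine Continuous.matrix_det ?_
    refine continuous_matrix fun i j => ?_
    have h2 := continuousOn_iteratedDeriv hI hγ (k := (j : ℕ) + 1) j.2
    have h3 : ContinuousOn (fun t => iteratedDeriv ((j : ℕ) + 1) γ t i) I :=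
      (EuclideanSpace.proj i : EuclideanSpace ℝ (Fin d) →L[ℝ] ℝ).continuous.comp_continuousOn h2
    exact continuousOn_iff_continuous_domRestrict.1 h3
  exact h1.abs.rpow_const fun t _ => Or.inr (by positivity)

/-- With d = n + 1, |L_γ|^{1/d} = λ_γ^{(d+1)/2}: one factor λ_γ for the measure and one square root
for each of the n pairs containing a given index. -/
theorem abs_torsion_rpow_eq {n : ℕ} {γ : ℝ → EuclideanSpace ℝ (Fin (n + 1))} (t : ℝ) :
    |torsion γ t| ^ (1 / ((n + 1 : ℕ) : ℝ)) =
      affineDensity γ t * Real.sqrt (affineDensity γ t) ^ n := by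
  have h0 : 0 ≤ affineDensity γ t := by unfold affineDensity; positivity
  have h1 : affineDensity γ t * Real.sqrt (affineDensity γ t) ^ n =
      affineDensity γ t ^ (1 + (1 / 2 : ℝ) * n) := by
    rw [Real.rpow_add_of_nonneg h0 (by norm_num) (by positivity), Real.rpow_one, Real.sqrt_eq_rpow,
      Real.rpow_mul h0, Real.rpow_natCast]
  rw [h1]
  unfold affineDensity
  rw [← Real.rpow_mul (abs_nonneg _)]
  congr 1
  push_cast
  field_simp
  ring

theorem LogConcaveOn.ordConnected_pos {I : Set ℝ} (hI : I.OrdConnected) {f : ℝ → ℝ}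
    (hf : LogConcaveOn I f) : (I ∩ {t | 0 < f t}).OrdConnected := by
  refine Convex.ordConnected ?_
  rintro x ⟨hx, hfx⟩ y ⟨hy, hfy⟩ a b ha hb hab
  refine ⟨hI.convex hx hy ha hb hab, ?_⟩
  have h1 := hf.2 x hx y hy a ⟨ha, by linarith⟩
  have h2 : 1 - a = b := by linarith
  rw [h2] at h1
  exact lt_of_lt_of_le (mul_pos (Real.rpow_pos_of_pos hfx _) (Real.rpow_pos_of_pos hfy _)) h1

theorem LogConcaveOn.mono {I J : Set ℝ} (hJ : J ⊆ I) {f : ℝ → ℝ} (hf : LogConcaveOn I f) :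
    LogConcaveOn J f :=
  ⟨fun t ht => hf.1 t (hJ ht), fun s hs t ht => hf.2 s (hJ hs) t (hJ ht)⟩

/-- At y ∈ F the operator measures the labels of the edges at y; labels outside J carry no weight.
-/
theorem pairing_convOp_le {m : ℕ} {I J : Set ℝ} (hI : IsOpen I) (hJ : MeasurableSet J)
    {γ γ' : ℝ → EuclideanSpace ℝ (Fin m)} (hγ' : Measurable γ') (hγγ' : ∀ t ∈ J, γ' t = γ t)
    {l : ℝ → ℝ} (hl : ∀ t ∈ J, l t = affineDensity γ t)
    (hl0 : ∀ t ∈ I, t ∉ J → affineDensity γ t ≤ 0)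
    {E F : Set (EuclideanSpace ℝ (Fin m))} (hE : MeasurableSet E) (hF : MeasurableSet F) :
    pairing (convOp γ I (charFn E)) (charFn F) ≤
      (volume.prod (volume.withDensity (J.indicator fun u => ENNReal.ofReal (l u))))
        (incidence γ' J E F) := by
  have hG := measurableSet_incidence hγ' hJ hE hF
  rw [← lintegral_degR hγ' hG]
  unfold pairing charFn convOp
  refine lintegral_mono fun y => ?_
  by_cases hy : y ∈ F
  · have hT : MeasurableSet {t | (y - γ' t, t) ∈ incidence γ' J E F} :=
      measurable_prodMk_left (measurableSet_shear hγ' hG)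
    unfold degR
    rw [withDensity_apply _ hT, ← lintegral_indicator hT, ← lintegral_indicator hI.measurableSet,
      Set.indicator_of_mem hy, mul_one]
    refine lintegral_mono fun t => ?_
    by_cases htI : t ∈ I
    · rw [Set.indicator_of_mem htI]
      by_cases htJ : t ∈ J
      · by_cases htE : y - γ t ∈ E
        · rw [Set.indicator_of_mem htE, Set.indicator_of_mem, Set.indicator_of_mem htJ, hl t htJ,
            one_mul]
          rw [Set.mem_ofPred_eq, hγγ' t htJ]
          exact ⟨htE, by simpa [hγγ' t htJ] using hy, htJ⟩
        · rw [Set.indicator_of_notMem htE, zero_mul]; exact zero_le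
      · rw [ENNReal.ofReal_of_nonpos (hl0 t htI htJ), mul_zero]; exact zero_le
    · rw [Set.indicator_of_notMem htI]; exact zero_le
  · rw [Set.indicator_of_notMem hy, mul_zero]; exact zero_le

theorem prod_withDensity_incidence_le {m : ℕ} {I J : Set ℝ} (hJ : MeasurableSet J)
    (hJI : J ⊆ I)
    {γ : ℝ → EuclideanSpace ℝ (Fin m)} (hγ : Measurable γ) {w : ℝ → ℝ≥0∞} (hw : Measurable w)
    {E F : Set (EuclideanSpace ℝ (Fin m))} (hE : MeasurableSet E) (hF : MeasurableSet F) :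
    (volume.prod (volume.withDensity (I.indicator w))) (incidence γ J E F) ≤
      (volume.prod (volume.withDensity (J.indicator w))) (incidence γ J E F) := by
  have hG := measurableSet_incidence hγ hJ hE hF
  rw [Measure.prod_apply hG, Measure.prod_apply hG]
  refine lintegral_mono fun x => ?_
  have hT : MeasurableSet (Prod.mk x ⁻¹' incidence γ J E F) := measurable_prodMk_left hG
  rw [withDensity_apply _ hT, withDensity_apply _ hT]
  refine setLIntegral_mono (hw.indicator hJ) fun t ht => ?_
  have htJ : t ∈ J := ht.2.2
  rw [Set.indicator_of_mem htJ, Set.indicator_of_mem (hJI htJ)]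

theorem exists_rat_mem_of_isOpen {I : Set ℝ} (hI : IsOpen I) {t : ℝ} (ht : t ∈ I) :
    ∃ p q : ℚ, (p : ℝ) ∈ I ∧ (q : ℝ) ∈ I ∧ t ∈ Set.Ioo (p : ℝ) q := by
  obtain ⟨ε, hε, hb⟩ := Metric.isOpen_iff.1 hI t ht
  obtain ⟨p, hp1, hp2⟩ := exists_rat_btwn (show t - ε < t by linarith)
  obtain ⟨q, hq1, hq2⟩ := exists_rat_btwn (show t < t + ε by linarith)
  refine ⟨p, q, hb ?_, hb ?_, hp2, hq1⟩ <;> rw [Metric.mem_ball, Real.dist_eq, abs_lt] <;>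
    constructor <;> linarith

/-- The restricted estimate for convolution with affine arclength measure. -/
theorem exists_pairing_convOp_bound (d : ℕ) (hd : 1 ≤ d) (Cγ c₁ c₂ : ℝ)
    (hCγ : 0 < Cγ) (hc₁ : 0 < c₁) (hc₂ : 0 < c₂) :
    ∃ C : ℝ, 0 < C ∧
      ∀ (I : Set ℝ) (γ : ℝ → EuclideanSpace ℝ (Fin d)) (f : ℝ → ℝ),
        IsOpen I → I.OrdConnected →
        ContDiffOn ℝ (d : WithTop ℕ∞) γ I →
        AffineArclength.GeometricInequality γ I Cγ →
        AffineArclength.LogConcaveOn I f →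
        (∀ t ∈ I, c₁ * f t ≤ AffineArclength.affineDensity γ t ∧
          AffineArclength.affineDensity γ t ≤ c₂ * f t) →
        ∀ E F : Set (EuclideanSpace ℝ (Fin d)),
          MeasurableSet E → MeasurableSet F → volume E < ∞ → volume F < ∞ →
          AffineArclength.pairing
              (AffineArclength.convOp γ I (AffineArclength.charFn E)) (AffineArclength.charFn F)
            ≤ ENNReal.ofReal C *
              volume E ^ (1 / (((d : ℝ) + 1) / 2)) *
              volume F ^ (1 / ((d : ℝ) * ((d : ℝ) + 1) / ((d : ℝ) ^ 2 - (d : ℝ) + 2))) := by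
  obtain ⟨n, rfl⟩ : ∃ n, d = n + 1 := ⟨d - 1, by omega⟩
  obtain ⟨C, hC, hbound⟩ := exists_incidence_bound n hCγ hc₁ hc₂
  refine ⟨C, hC, fun I γ f hIo hI hγ hgeom hf hlf E F hE hF hEf hFf => ?_⟩
  have hdens := continuousOn_affineDensity hIo hγ
  -- Log-concavity makes I' an interval. It is open because comparability identifies it with the set
  -- where the continuous density λ_γ is positive.
  set I' : Set ℝ := I ∩ {t | 0 < f t} with hI'
  have hI'c : I'.OrdConnected := hf.ordConnected_pos hI
  have hI'o : IsOpen I' := by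
    have : I' = I ∩ affineDensity γ ⁻¹' Set.Ioi 0 := by
      ext t
      refine and_congr_right fun ht => ⟨fun h => ?_, fun h => ?_⟩
      · exact (mul_pos hc₁ h).trans_le (hlf t ht).1
      · exact pos_of_mul_pos_right (lt_of_lt_of_le h (hlf t ht).2) hc₂.le
    rw [this]
    exact hdens.isOpen_inter_preimage hIo isOpen_Ioi
  -- Nothing is known about γ off I; cutting it off gives a globally measurable curve with the same
  -- derivative on the open set I.
  set γ' := I.indicator γ with hγ'
  set l := I.indicator (affineDensity γ) with hl
  have hγ'm : Measurable γ' := measurable_indicator_of_continuousOn hIo hγ.continuousOn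
  have hlm : Measurable l := measurable_indicator_of_continuousOn hIo hdens
  have hleq : ∀ t ∈ I, l t = affineDensity γ t := fun t ht => Set.indicator_of_mem ht _
  have hder : ∀ t ∈ I, HasDerivAt γ (deriv γ t) t := fun t ht =>
    ((hγ.differentiableOn (by simp)).differentiableAt (hIo.mem_nhds ht)).hasDerivAt
  have hder' : ∀ t ∈ I, HasDerivAt γ' (deriv γ t) t := fun t ht =>
    (hder t ht).congr_of_eventuallyEq (by
      filter_upwards [hIo.mem_nhds ht] with s hs
      exact Set.indicator_of_mem hs _)
  have hdc : ContinuousOn (deriv γ) I := by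
    have := continuousOn_iteratedDeriv hIo hγ (k := 1) (by omega)
    rwa [iteratedDeriv_one] at this
  refine (pairing_convOp_le (J := I') hIo hI'o.measurableSet hγ'm
    (fun t ht => Set.indicator_of_mem ht.1 _) (fun t ht => hleq t ht.1)
    (fun t ht ht' => ?_) hE hF).trans ?_
  · have h1 : f t = 0 := le_antisymm (not_lt.1 fun h => ht' ⟨ht, h⟩) (hf.1 t ht)
    have := (hlf t ht).2
    rwa [h1, mul_zero] at this
  -- The mass of I' may be infinite. Intervals with rational ends in I' form a countable directed
  -- family exhausting I', and λ_γ is bounded on each by compactness, so the uniform bound passes to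
  -- the supremum.
  set ι := {x : ℚ × ℚ // (x.1 : ℝ) ∈ I' ∧ (x.2 : ℝ) ∈ I'} with hι
  have hunion : incidence γ' I' E F =
      ⋃ i : ι, incidence γ' (Set.Ioo (i.1.1 : ℝ) i.1.2) E F := by
    ext p
    rw [Set.mem_iUnion]
    constructor
    · rintro ⟨h1, h2, h3⟩
      obtain ⟨a, b, ha, hb, hab⟩ := exists_rat_mem_of_isOpen hI'o h3
      exact ⟨⟨(a, b), ha, hb⟩, h1, h2, hab⟩
    · rintro ⟨⟨⟨a, b⟩, ha, hb⟩, h1, h2, h3⟩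
      exact ⟨h1, h2, hI'c.out ha hb ⟨h3.1.le, h3.2.le⟩⟩
  have hdir : Directed (· ⊆ ·) fun i : ι =>
      incidence γ' (Set.Ioo (i.1.1 : ℝ) i.1.2) E F := by
    rintro ⟨⟨a, b⟩, ha, hb⟩ ⟨⟨a', b'⟩, ha', hb'⟩
    refine ⟨⟨(min a a', max b b'), ?_, ?_⟩, ?_, ?_⟩
    · rcases min_choice a a' with h | h <;> simp only [h] <;> assumption
    · rcases max_choice b b' with h | h <;> simp only [h] <;> assumption
    · rintro p ⟨h1, h2, h3⟩
      refine ⟨h1, h2, Set.Ioo_subset_Ioo ?_ ?_ h3⟩ <;> simp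
    · rintro p ⟨h1, h2, h3⟩
      refine ⟨h1, h2, Set.Ioo_subset_Ioo ?_ ?_ h3⟩ <;> simp
  rw [hunion, hdir.measure_iUnion]
  refine iSup_le fun i => ?_
  obtain ⟨⟨a, b⟩, ha, hb⟩ := i
  have hIcc : Set.Icc (a : ℝ) b ⊆ I' := hI'c.out ha hb
  have hJI' : Set.Ioo (a : ℝ) b ⊆ I' := Set.Ioo_subset_Icc_self.trans hIcc
  have hJI : Set.Ioo (a : ℝ) b ⊆ I := hJI'.trans Set.inter_subset_left
  refine (prod_withDensity_incidence_le measurableSet_Ioo hJI' hγ'm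
    hlm.ennreal_ofReal hE hF).trans ?_
  refine hbound (Set.Ioo (a : ℝ) b) γ' (deriv γ) f l Set.ordConnected_Ioo isOpen_Ioo hγ'm
    (fun t ht => hder' t (hJI ht)) (hdc.mono hJI) hlm ?_ (hf.mono hJI)
    (fun t ht => (hJI' ht).2) (fun t ht => by rw [hleq t (hJI ht)]; exact hlf t (hJI ht)) ?_
    E F hE hF hEf hFf
  · obtain ⟨B, hB⟩ := isCompact_Icc.bddAbove_image
      (hdens.mono (hIcc.trans Set.inter_subset_left))
    rw [lintegral_indicator measurableSet_Ioo]
    refine ((setLIntegral_mono (g := fun _ => ENNReal.ofReal B) measurable_const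
      fun t ht => ?_).trans_lt ?_).ne
    · rw [hleq t (hJI ht)]
      exact ENNReal.ofReal_le_ofReal
        (hB (Set.mem_image_of_mem _ (Set.Ioo_subset_Icc_self ht)))
    · rw [setLIntegral_const]
      exact ENNReal.mul_lt_top ENNReal.ofReal_lt_top (by simp)
  · intro t ht
    rw [abs_jacobian_eq fun j => hder' _ (hJI (ht j)),
      ← abs_jacobian_eq fun j => hder _ (hJI (ht j))]
    refine le_trans (le_of_eq ?_) (hgeom t fun j => hJI (ht j))
    congr 2
    refine Finset.prod_congr rfl fun j _ => ?_
    rw [hleq _ (hJI (ht j)), abs_torsion_rpow_eq]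

end AffineArclength

theorem proposition3p1 (d : ℕ) (hd : 1 ≤ d) (Cγ c₁ c₂ : ℝ)
    (hCγ : 0 < Cγ) (hc₁ : 0 < c₁) (hc₂ : 0 < c₂) :
    ∃ C : ℝ, 0 < C ∧
      ∀ (I : Set ℝ) (γ : ℝ → EuclideanSpace ℝ (Fin d)) (f : ℝ → ℝ),
        IsOpen I → I.OrdConnected →
        ContDiffOn ℝ (d : WithTop ℕ∞) γ I →
        AffineArclength.GeometricInequality γ I Cγ →
        AffineArclength.LogConcaveOn I f →
        (∀ t ∈ I, c₁ * f t ≤ AffineArclength.affineDensity γ t ∧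
          AffineArclength.affineDensity γ t ≤ c₂ * f t) →
        ∀ E F : Set (EuclideanSpace ℝ (Fin d)),
          MeasurableSet E → MeasurableSet F → volume E < ∞ → volume F < ∞ →
          AffineArclength.pairing
              (AffineArclength.convOp γ I (AffineArclength.charFn E)) (AffineArclength.charFn F)
            ≤ ENNReal.ofReal C *
              volume E ^ (1 / (((d : ℝ) + 1) / 2)) *
              volume F ^ (1 / ((d : ℝ) * ((d : ℝ) + 1) / ((d : ℝ) ^ 2 - (d : ℝ) + 2))) := by
  exact AffineArclength.exists_pairing_convOp_bound d hd Cγ c₁ c₂ hCγ hc₁ hc₂
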